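/- **Setting.** Let $\Omega\subset\mathbb R^3$ be a bounded domain (open, connected) whose boundary $\Gamma$ has connected components $\Gamma_0,\dots,\Gamma_m$, with $\Gamma_0$ the exterior one. Let $\mathcal T_h$ be a finite partition of $\overline\Omega$ into closed polyhedra $T$ (not necessarily convex) with flat polygonal faces, such that every face either lies on $\Gamma$ and belongs to exactly one element, or has its relative interior in $\Omega$ and is shared by exactly two elements. Let $\mathcal E_h^0$ be the set of interior faces, $h_T=\operatorname{diam}T$ and $h=\max_T h_T$. Assume that the partition is shape-regular and quasi-uniform: for some $\varrho>0$ and $n\in\mathbb N$ and all elements $T$ and faces $e\subset\partial T$, (i) $|T|\ge\varrho h_T^3$, $|e|\ge\varrho h_e^2$ and $h_e\ge\varrho h_T$, where $h_e=\operatorname{diam}e$; (ii) $T$ contains a pyramid with base $e$, apex in $T$ (on the inner side of $e$) and height at least $\varrho h_T$; (iii) $T$ has at most $n$ faces; (iv) $h_T\ge\varrho h$. Let $\mu,\kappa$ be symmetric $3\times3$ matrix functions, constant on each element, with all eigenvalues in $[\alpha,\Lambda]$, $\alpha>0$. Let $k\ge1$. Put $W_h=\{q\in L^2(\Omega): q|_T\in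 P_{k-1}(T)\ \forall T\in\mathcal T_h\}$. Let $V_h$ be the space of pairs $\mathbf v=\{\mathbf v_0,\mathbf v_b\}$ with $\mathbf v_0|_T\in[P_k(T)]^3$ on each element and $\mathbf v_b|_e\in[P_k(e)]^3$ single-valued on each face, and let $$U_h^0=\{\mathbf v\in V_h:\ \mathbf v_b\times\mathbf n=0\text{ on }\Gamma,\ \langle\mathbf v_b\cdot\mathbf n_i,1\rangle_{\Gamma_i}=0,\ i=1,\dots,m\},$$ where $\mathbf n_i$ is the unit outward normal on $\Gamma_i$. On each $T$, with $\mathbf n$ the unit outward normal of $T$, define $\nabla_w\cdot(\mu\mathbf v)\in P_{k-1}(T)$ and $\nabla_w\times\mathbf v\in[P_{k-1}(T)]^3$ by $$(\nabla_w\cdot(\mu\mathbf v),\varphi)_T=-(\mu\mathbf v_0,\nabla\varphi)_T+\langle\mathbf v_b\cdot\mathbf n,\varphi\rangle_{\partial T}\quad\forall\varphi\in P_{k-1}(T),$$ $$(\nabla_w\times\mathbf v,\varphi)_T=(\mathbf v_0,\nabla\times\varphi)_T-\langle\mathbf v_b\times\mathbf n,\varphi\rangle_{\partial T}\quad\forall\varphi\in[P_{k-1}(T)]^3.$$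 Set $b(\mathbf v,q)=\sum_T(\nabla_w\cdot(\mu\mathbf v),q)_T$, $$|||\mathbf v|||^2=\sum_T\Big((\kappa\nabla_w\times\mathbf v,\nabla_w\times\mathbf v)_T+h_T^{-1}\|(\mu\mathbf v_0-\mathbf v_b)\cdot\mathbf n\|_{\partial T}^2+h_T^{-1}\|(\mathbf v_0-\mathbf v_b)\times\mathbf n\|_{\partial T}^2\Big),$$ $$\|q\|_{W_h}^2=h^2\sum_T\|\nabla q\|_T^2+h\sum_{e\in\mathcal E_h^0}\|[[q]]_e\|_e^2+h\sum_{i=0}^m\|q-\bar q_i\|_{\Gamma_i}^2,$$ where $[[q]]_e$ is the jump of $q$ across $e$, $\bar q_0=0$, and $\bar q_i$ is the average of $q$ on $\Gamma_i$ for $i=1,\dots,m$. **Lemma 10.1 (inf-sup condition).** There are constants $C,\beta>0$, depending only on $k,\varrho,n,\alpha,\Lambda$, such that in the above setting, for every $q\in W_h$ there exists $\mathbf v_q\in U_h^0$ with $$b(\mathbf v_q,q)=h^2\sum_{T\in\mathcal T_h}(\mu\nabla q,\nabla q)_T+h\sum_{e\in\mathcal E_h^0}\|[[q]]_e\|_e^2+h\sum_{i=0}^m\|q-\bar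 q_i\|_{\Gamma_i}^2,\qquad |||\mathbf v_q|||\le C\,\|q\|_{W_h}.$$ Consequently the discrete inf-sup condition $$\beta\,\|q\|_{W_h}\le\sup_{\mathbf v\in U_h^0}\frac{b(\mathbf v,q)}{|||\mathbf v|||}\qquad\forall q\in W_h$$ holds, where a quotient with $|||\mathbf v|||=0$ is read as $+\infty$ if $b(\mathbf v,q)>0$ and as $0$ otherwise. -/

import Mathlib

open MeasureTheory Set Topology
open scoped Matrix

namespace WG

/-- Three-dimensional Euclidean space. -/
abbrev E3 := EuclideanSpace ℝ (Fin 3)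

/-! ### Polyhedra and polygons -/

/-- A nondegenerate closed tetrahedron. -/
def IsTetrahedron (s : Set E3) : Prop :=
  ∃ p : Fin 4 → E3, AffineIndependent ℝ p ∧ s = convexHull ℝ (range p)

/-- A nondegenerate closed triangle. -/
def IsTriangle (s : Set E3) : Prop :=
  ∃ p : Fin 3 → E3, AffineIndependent ℝ p ∧ s = convexHull ℝ (range p)

/-- A closed (not necessarily convex) polyhedron: a finite union of tetrahedra with connected
interior. -/
def IsPolyhedron (T : Set E3) : Prop :=
  IsConnected (interior T) ∧
    ∃ S : Set (Set E3), S.Finite ∧ (∀ s ∈ S, IsTetrahedron s) ∧ T = ⋃₀ S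

/-- A flat closed (not necessarily convex) polygon in space: a connected coplanar finite union of
triangles. -/
def IsPolygon (e : Set E3) : Prop :=
  IsConnected e ∧ Coplanar ℝ e ∧
    ∃ S : Set (Set E3), S.Finite ∧ (∀ s ∈ S, IsTriangle s) ∧ e = ⋃₀ S

/-- `n` is the unit normal of the flat face `e` of the polyhedron `T`, pointing out of `T`. -/
def IsOutwardUnitNormal (T e : Set E3) (n : E3) : Prop :=
  ‖n‖ = 1 ∧ (∀ x ∈ e, ∀ y ∈ e, inner ℝ n (x - y) = 0) ∧
    ∀ x ∈ intrinsicInterior ℝ e,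
      ∀ᶠ t : ℝ in 𝓝[>] 0, x - t • n ∈ interior T ∧ x + t • n ∉ T

/-! ### The domain and the components of its boundary -/

/-- `Γ 0, …, Γ m` are the pairwise distinct connected components of the boundary of `Ω`, and `Γ 0`
is the exterior one: it contains the boundary of the unbounded part of the complement. -/
structure IsBoundaryComponents (Ω : Set E3) {m : ℕ} (Γ : Fin (m + 1) → Set E3) : Prop where
  component : ∀ i, ∃ x ∈ frontier Ω, Γ i = connectedComponentIn (frontier Ω) x
  injective : Function.Injective Γ
  iUnion_eq : ⋃ i, Γ i = frontier Ω
  exterior : frontier {x | x ∈ (closure Ω)ᶜ ∧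
    ¬ Bornology.IsBounded (connectedComponentIn (closure Ω)ᶜ x)} ⊆ Γ 0

/-! ### Polyhedral partitions -/

/-- A finite element partition of `Ω` into `N` closed polyhedra with `M` flat faces. Each face `e`
carries a prescribed orientation `normal e`, which points out of the element `left e`; the element
on the other side is `right e`, with value `none` exactly when `e` is a boundary face. -/
structure PolyMesh (Ω : Set E3) (N M : ℕ) where
  cell : Fin N → Set E3
  face : Fin M → Set E3
  left : Fin M → Fin N
  right : Fin M → Option (Fin N)
  normal : Fin M → E3
  polyhedron : ∀ T, IsPolyhedron (cell T)
  polygon : ∀ e, IsPolygon (face e)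
  iUnion_cell : ⋃ T, cell T = closure Ω
  disjoint_cell : ∀ T T', T ≠ T' → Disjoint (interior (cell T)) (interior (cell T'))
  disjoint_face : ∀ e e', e ≠ e' →
    Disjoint (intrinsicInterior ℝ (face e)) (intrinsicInterior ℝ (face e'))
  right_ne_left : ∀ e, right e ≠ some (left e)
  frontier_cell : ∀ T,
    frontier (cell T) = ⋃ e ∈ {e | left e = T ∨ right e = some T}, face e
  frontier_domain : frontier Ω = ⋃ e ∈ {e | right e = none}, face e
  interior_face : ∀ e, right e ≠ none → intrinsicInterior ℝ (face e) ⊆ Ω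
  normal_left : ∀ e, IsOutwardUnitNormal (cell (left e)) (face e) (normal e)
  normal_right : ∀ e T, right e = some T →
    IsOutwardUnitNormal (cell T) (face e) (-normal e)

noncomputable section

/-! ### Polynomials -/

/-- `P_r`: real polynomials in three variables of total degree at most `r`. A polynomial on a
polyhedron is identified with its coefficients; a polynomial on a flat face is the restriction to
the face of an element of `P_r`. -/
abbrev Poly (r : ℕ) : Type := MvPolynomial.restrictTotalDegree (Fin 3) ℝ r

/-- Value of a polynomial at a point. -/
def ev (p : MvPolynomial (Fin 3) ℝ) (x : E3) : ℝ := MvPolynomial.eval x.ofLp p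

/-- Value of a polynomial vector field at a point. -/
def evVec {r : ℕ} (p : Fin 3 → Poly r) (x : E3) : Fin 3 → ℝ := fun i => ev (p i) x

/-- Value of the gradient of a polynomial at a point. -/
def gradAt (p : MvPolynomial (Fin 3) ℝ) (x : E3) : Fin 3 → ℝ :=
  fun i => ev (MvPolynomial.pderiv i p) x

/-- Value of the curl of a polynomial vector field at a point. -/
def curlAt {r : ℕ} (p : Fin 3 → Poly r) (x : E3) : Fin 3 → ℝ :=
  ![gradAt (p 2) x 1 - gradAt (p 1) x 2,
    gradAt (p 0) x 2 - gradAt (p 2) x 0,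
    gradAt (p 1) x 0 - gradAt (p 0) x 1]

/-- Symmetric matrix all of whose eigenvalues lie in `[α, Λ]`. -/
def IsSymmBetween (α Λ : ℝ) (A : Matrix (Fin 3) (Fin 3) ℝ) : Prop :=
  A.IsSymm ∧ ∀ ξ : Fin 3 → ℝ, α * (ξ ⬝ᵥ ξ) ≤ ξ ⬝ᵥ (A *ᵥ ξ) ∧ ξ ⬝ᵥ (A *ᵥ ξ) ≤ Λ * (ξ ⬝ᵥ ξ)

/-- The finite element space `W_h` (for polynomial degree `k - 1`): a piecewise polynomial is
given by its restrictions to the elements. -/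
abbrev WSpace (k N : ℕ) : Type := Fin N → Poly (k - 1)

/-- The weak finite element space `V_h`: `v = {v₀, v_b}` with `v₀` of degree at most `k` on each
element and `v_b` of degree at most `k` on each face, single-valued on interior faces. -/
structure VSpace (k N M : ℕ) : Type where
  inner : Fin N → Fin 3 → Poly k
  bdry : Fin M → Fin 3 → Poly k

namespace PolyMesh

variable {Ω : Set E3} {N M : ℕ} (𝒯 : PolyMesh Ω N M)

/-- The faces of an element. -/
def facesOf (T : Fin N) : Finset (Fin M) :=
  Finset.univ.filter fun e => 𝒯.left e = T ∨ 𝒯.right e = some T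

/-- Outward unit normal of the element `T` on its face `e`. -/
def outNormal (T : Fin N) (e : Fin M) : E3 :=
  if 𝒯.left e = T then 𝒯.normal e else -𝒯.normal e

/-- `h_T`, the diameter of an element. -/
def hT (T : Fin N) : ℝ := Metric.diam (𝒯.cell T)

/-- The mesh size `h`, the largest diameter of an element. -/
def h : ℝ := ⨆ T, 𝒯.hT T

/-- Integral over an element. -/
def cellInt (T : Fin N) (f : E3 → ℝ) : ℝ := ∫ x in 𝒯.cell T, f x

/-- Surface integral over a face (`μHE[2]` is the surface area measure). -/
def faceInt (e : Fin M) (f : E3 → ℝ) : ℝ := ∫ x in 𝒯.face e, f x ∂μHE[2]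

/-- Integral over the boundary of an element of a function of the point and of the outward unit
normal, where the first argument of `f` is the face on which the point lies. -/
def bdryInt (T : Fin N) (f : Fin M → (Fin 3 → ℝ) → E3 → ℝ) : ℝ :=
  ∑ e ∈ 𝒯.facesOf T, 𝒯.faceInt e (f e (𝒯.outNormal T e).ofLp)

/-- Shape regularity of a polyhedral partition with parameters `ρ` and `n`. Volumes of elements,
areas and diameters of faces are bounded below by the powers of the diameters; every face of an
element is the base of a pyramid contained in the element whose height is at least `ρ h_T`; and
every element has at most `n` faces. -/
structure ShapeRegular (ρ : ℝ) (n : ℕ) : Prop where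
  volume_ge : ∀ T, ρ * 𝒯.hT T ^ 3 ≤ volume.real (𝒯.cell T)
  area_ge : ∀ e, ρ * Metric.diam (𝒯.face e) ^ 2 ≤ (μHE[2] : Measure E3).real (𝒯.face e)
  diam_ge : ∀ T, ∀ e ∈ 𝒯.facesOf T, ρ * 𝒯.hT T ≤ Metric.diam (𝒯.face e)
  pyramid : ∀ T, ∀ e ∈ 𝒯.facesOf T, ∃ A ∈ 𝒯.cell T,
    convexJoin ℝ {A} (𝒯.face e) ⊆ 𝒯.cell T ∧
      ∀ x ∈ 𝒯.face e, ρ * 𝒯.hT T ≤ inner ℝ (𝒯.outNormal T e) (x - A)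
  card_le : ∀ T, (𝒯.facesOf T).card ≤ n

/-- Quasi-uniformity with parameter `ρ`: the diameters of all elements are comparable to `h`. -/
def QuasiUniform (ρ : ℝ) : Prop := ∀ T, ρ * 𝒯.h ≤ 𝒯.hT T

open Classical in
/-- The boundary faces contained in a part `G` of the boundary. -/
def facesIn (G : Set E3) : Finset (Fin M) :=
  Finset.univ.filter fun e => 𝒯.right e = none ∧ 𝒯.face e ⊆ G

/-- The interior faces. -/
def interiorFaces : Finset (Fin M) :=
  Finset.univ.filter fun e => 𝒯.right e ≠ none

variable {k : ℕ}

/-! ### Weak divergence and weak curl -/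

/-- `d` is the discrete weak divergence of `μ v` on the element `T`: a polynomial of degree at most
`k - 1` with `(d, φ)_T = -(μ v₀, ∇φ)_T + ⟨v_b · n, φ⟩_∂T` for all `φ ∈ P_{k-1}(T)`. -/
def IsWeakDiv (μ : Fin N → Matrix (Fin 3) (Fin 3) ℝ) (v : VSpace k N M) (T : Fin N)
    (d : Poly (k - 1)) : Prop :=
  ∀ φ : Poly (k - 1),
    𝒯.cellInt T (fun x => ev d x * ev φ x) =
      -𝒯.cellInt T (fun x => (μ T *ᵥ evVec (v.inner T) x) ⬝ᵥ gradAt φ x) +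
        𝒯.bdryInt T (fun e n x => (evVec (v.bdry e) x ⬝ᵥ n) * ev φ x)

/-- The discrete weak divergence of `μ v` on the element `T`. -/
def weakDiv (μ : Fin N → Matrix (Fin 3) (Fin 3) ℝ) (v : VSpace k N M) (T : Fin N) :
    Poly (k - 1) :=
  Classical.epsilon (𝒯.IsWeakDiv μ v T)

/-- `c` is the discrete weak curl of `v` on the element `T`: a polynomial vector field of degree at
most `k - 1` with `(c, φ)_T = (v₀, ∇ × φ)_T - ⟨v_b × n, φ⟩_∂T` for all `φ ∈ [P_{k-1}(T)]³`. -/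
def IsWeakCurl (v : VSpace k N M) (T : Fin N) (c : Fin 3 → Poly (k - 1)) : Prop :=
  ∀ φ : Fin 3 → Poly (k - 1),
    𝒯.cellInt T (fun x => evVec c x ⬝ᵥ evVec φ x) =
      𝒯.cellInt T (fun x => evVec (v.inner T) x ⬝ᵥ curlAt φ x) -
        𝒯.bdryInt T (fun e n x => (evVec (v.bdry e) x ⨯₃ n) ⬝ᵥ evVec φ x)

/-- The discrete weak curl of `v` on the element `T`. -/
def weakCurl (v : VSpace k N M) (T : Fin N) : Fin 3 → Poly (k - 1) :=
  Classical.epsilon (𝒯.IsWeakCurl v T)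

/-! ### Bilinear forms and norms -/

/-- `b(v, q) = ∑_T (∇_w · (μ v), q)_T`. -/
def b (μ : Fin N → Matrix (Fin 3) (Fin 3) ℝ) (v : VSpace k N M) (q : WSpace k N) : ℝ :=
  ∑ T, 𝒯.cellInt T (fun x => ev (𝒯.weakDiv μ v T) x * ev (q T) x)

/-- The stabilizer `s(v, w)`. -/
def s (μ : Fin N → Matrix (Fin 3) (Fin 3) ℝ) (v w : VSpace k N M) : ℝ :=
  ∑ T, (𝒯.hT T)⁻¹ * 𝒯.bdryInt T (fun e n x =>
      ((μ T *ᵥ evVec (v.inner T) x - evVec (v.bdry e) x) ⬝ᵥ n) *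
        ((μ T *ᵥ evVec (w.inner T) x - evVec (w.bdry e) x) ⬝ᵥ n)) +
  ∑ T, (𝒯.hT T)⁻¹ * 𝒯.bdryInt T (fun e n x =>
      ((evVec (v.inner T) x - evVec (v.bdry e) x) ⨯₃ n) ⬝ᵥ
        ((evVec (w.inner T) x - evVec (w.bdry e) x) ⨯₃ n))

/-- `a(v, w) = ∑_T (κ ∇_w × v, ∇_w × w)_T + s(v, w)`. -/
def a (μ κ : Fin N → Matrix (Fin 3) (Fin 3) ℝ) (v w : VSpace k N M) : ℝ :=
  ∑ T, 𝒯.cellInt T (fun x =>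
      (κ T *ᵥ evVec (𝒯.weakCurl v T) x) ⬝ᵥ evVec (𝒯.weakCurl w T) x) +
    𝒯.s μ v w

/-- The seminorm `|||v||| = a(v, v)^{1/2}`. -/
def tripleNorm (μ κ : Fin N → Matrix (Fin 3) (Fin 3) ℝ) (v : VSpace k N M) : ℝ :=
  √(𝒯.a μ κ v v)

/-- The jump of `q` across the face `e`, with respect to the orientation of `e` (the value from the
left element minus the value from the right one). -/
def jump (q : WSpace k N) (e : Fin M) (x : E3) : ℝ :=
  ev (q (𝒯.left e)) x - (𝒯.right e).elim 0 (fun T => ev (q T) x)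

/-- Average of (the trace of) `q` over a part `G` of the boundary. -/
def bdryAverage (q : WSpace k N) (G : Set E3) : ℝ :=
  (∑ e ∈ 𝒯.facesIn G, 𝒯.faceInt e (fun x => ev (q (𝒯.left e)) x)) /
    ∑ e ∈ 𝒯.facesIn G, 𝒯.faceInt e (fun _ => 1)

variable {m : ℕ}

/-- `q̄_0 = 0`, and `q̄_i` is the average of `q` over `Γ_i` for `i = 1, …, m`. -/
def qbar (Γ : Fin (m + 1) → Set E3) (q : WSpace k N) (i : Fin (m + 1)) : ℝ :=
  if i = 0 then 0 else 𝒯.bdryAverage q (Γ i)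

/-- `∑_{e interior} ‖[[q]]‖_e²`. -/
def jumpSq (q : WSpace k N) : ℝ :=
  ∑ e ∈ 𝒯.interiorFaces, 𝒯.faceInt e (fun x => 𝒯.jump q e x ^ 2)

/-- `∑_{i=0}^m ‖q - q̄_i‖_{Γ_i}²`. -/
def bdrySq (Γ : Fin (m + 1) → Set E3) (q : WSpace k N) : ℝ :=
  ∑ i, ∑ e ∈ 𝒯.facesIn (Γ i),
    𝒯.faceInt e (fun x => (ev (q (𝒯.left e)) x - 𝒯.qbar Γ q i) ^ 2)

/-- The mesh-dependent norm `‖q‖_{W_h}`. -/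
def normW (Γ : Fin (m + 1) → Set E3) (q : WSpace k N) : ℝ :=
  √(𝒯.h ^ 2 * ∑ T, 𝒯.cellInt T (fun x => gradAt (q T) x ⬝ᵥ gradAt (q T) x) +
    𝒯.h * 𝒯.jumpSq q + 𝒯.h * 𝒯.bdrySq Γ q)

/-- The test space `U_h⁰`: `v_b × n = 0` on the boundary of the domain, and
`⟨v_b · n_i, 1⟩_{Γ_i} = 0` for `i = 1, …, m`. -/
def U0 (Γ : Fin (m + 1) → Set E3) : Set (VSpace k N M) :=
  {v | (∀ e, 𝒯.right e = none → ∀ x ∈ 𝒯.face e,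
          evVec (v.bdry e) x ⨯₃ (𝒯.normal e).ofLp = 0) ∧
        ∀ i, i ≠ 0 →
          ∑ e ∈ 𝒯.facesIn (Γ i),
            𝒯.faceInt e (fun x => evVec (v.bdry e) x ⬝ᵥ (𝒯.normal e).ofLp) = 0}

end PolyMesh

end

end WG

/-!
The test function is explicit: `v = {-h² ∇q, g n_e}` (`PolyMesh.testFun`), where the normal
component `g` (`PolyMesh.normalPart`) is `h [[q]]` on interior faces and `h (q - q̄ᵢ)` on the boundary
component with index `i`. Every boundary face lies in exactly one component because faces are
connected. For `i ≠ 0`, `q - q̄ᵢ` has mean zero over that component, which gives membership in the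
test space; as `q̄₀ = 0`, it also turns `⟨q - q̄ᵢ, q⟩` into `‖q - q̄ᵢ‖²` for all `i`. Testing the definition of the weak divergence with `q`
itself and summing over the elements, each interior face being visited from both sides, gives the
identity for `b(v, q)` (`PolyMesh.b_testFun`, `PolyMesh.sum_faceInt_normalPart_mul_jump`).

For the bound on the energy seminorm (`PolyMesh.exists_a_testFun_le`), the boundary part of `v` is
normal to every face, so it contributes neither to the weak curl nor to the tangential stabilizer.
What remains needs only the inverse inequality for the curl of a polynomial and the trace inequality
for `∇q` (`PolyMesh.exists_trace_inverse_le`). Both follow from a pointwise inverse estimate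
(`exists_sq_ev_le`) which, for elements of arbitrary shape, uses only that an element of diameter
`h_T` has volume at least `ρ h_T³`. After scaling to the unit ball this is a Remez-type statement:
the `L²` norm of a polynomial over *any* subset of the ball of volume at least `ρ` controls all its
coefficients. It is proved by compactness of the unit sphere of coefficients, since the zero set of
a nonzero polynomial is null and hence sublevel sets have uniformly small volume
(`exists_le_setIntegral_sq_sum`). Faces have area at most `π h_T²` because they are planar.

Coercivity of `μ` then bounds `b(v, q)` from below by a multiple of `‖q‖²`, and the inf-sup condition
follows by using `v` in the supremum.
-/

namespace WG

/-! ### Polynomials of bounded degree on sets of large volume -/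

/-- By induction on the number of variables, with Fubini: where the leading coefficient in the first
variable does not vanish, a slice of the zero set is finite. -/
theorem volume_zeroSet_mvPolynomial {n : ℕ} {p : MvPolynomial (Fin n) ℝ} (hp : p ≠ 0) :
    volume {x : Fin n → ℝ | MvPolynomial.eval x p = 0} = 0 := by
  induction n with
  | zero =>
    have h : {x : Fin 0 → ℝ | MvPolynomial.eval x p = 0} = ∅ := by
      ext x
      simp only [mem_ofPred_eq, mem_empty_iff_false, iff_false]
      intro hx
      apply hp
      rw [MvPolynomial.eq_C_of_isEmpty p] at hx ⊢
      rw [MvPolynomial.eval_C] at hx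
      rw [hx, map_zero]
    rw [h, measure_empty]
  | succ n ih =>
    set f := MvPolynomial.finSuccEquiv ℝ n p with hf
    have hf0 : f ≠ 0 := by simpa [hf] using hp
    have hl : f.leadingCoeff ≠ 0 := by simpa using hf0
    have hmp := (volume_preserving_piFinSuccAbove (fun _ : Fin (n + 1) => ℝ) 0).symm
    have hms : MeasurableSet {x : Fin (n + 1) → ℝ | MvPolynomial.eval x p = 0} :=
      (isClosed_eq (MvPolynomial.continuous_eval p) continuous_const).measurableSet
    rw [← hmp.measure_preimage hms.nullMeasurableSet, Measure.volume_eq_prod,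
      ← Measure.prod_swap, Measure.map_apply measurable_swap (hmp.measurable hms)]
    refine Measure.measure_prod_null_of_ae_null (measurable_swap (hmp.measurable hms)) ?_
    have hae : ∀ᵐ y : Fin n → ℝ, MvPolynomial.eval y f.leadingCoeff ≠ 0 := by
      rw [ae_iff]; simpa using ih hl
    filter_upwards [hae] with y hy
    -- for almost every `y` the slice is the root set of a nonzero univariate polynomial
    set g := f.map (MvPolynomial.eval y) with hg
    have hg0 : g ≠ 0 := by
      intro h0
      apply hy
      have := congrArg (fun r => r.coeff f.natDegree) h0
      simpa [hg, Polynomial.coeff_map] using this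
    refine (Set.Finite.subset g.roots.toFinset.finite_toSet ?_).measure_zero _
    intro t ht
    simp only [mem_preimage, mem_ofPred_eq, Prod.swap_prod_mk] at ht
    have h2 := MvPolynomial.eval_eq_eval_mv_eval' y t p
    rw [← hf, ← hg] at h2
    have h3 : (MeasurableEquiv.piFinSuccAbove (fun _ : Fin (n + 1) => ℝ) 0).symm (t, y)
        = Fin.cons t y := by
      simp [MeasurableEquiv.piFinSuccAbove]
      rfl
    rw [h3, h2] at ht
    simp [hg0, ht]

theorem continuous_ev (p : MvPolynomial (Fin 3) ℝ) : Continuous (ev p) :=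
  (MvPolynomial.continuous_eval p).comp (PiLp.continuous_ofLp 2 _)

theorem volume_zeroSet_ev {p : MvPolynomial (Fin 3) ℝ} (hp : p ≠ 0) :
    volume {x : E3 | ev p x = 0} = 0 := by
  have h := (PiLp.volume_preserving_ofLp (Fin 3)).measure_preimage
    (s := {x : Fin 3 → ℝ | MvPolynomial.eval x p = 0})
    ((isClosed_eq (MvPolynomial.continuous_eval p) continuous_const).measurableSet.nullMeasurableSet)
  rw [volume_zeroSet_mvPolynomial hp] at h
  exact h

/-- A Remez-type inequality by compactness: on a finite-dimensional space of continuous functions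
whose nonzero members have null zero sets, the square of the coefficient norm is controlled by the
integral of the square over *any* subset of a fixed compact set with volume at least `ρ`. -/
theorem exists_le_setIntegral_sq_sum {d : ℕ} (f : Fin d → E3 → ℝ) (hf : ∀ i, Continuous (f i))
    {K : Set E3} (hK : IsCompact K)
    (hnull : ∀ c : Fin d → ℝ, c ≠ 0 → volume {y | ∑ i, c i * f i y = 0} = 0)
    {ρ : ℝ} (hρ : 0 < ρ) :
    ∃ δ > 0, ∀ c : Fin d → ℝ, ∀ S ⊆ K, MeasurableSet S → ρ ≤ volume.real S →
      δ * ‖c‖ ^ 2 ≤ ∫ y in S, (∑ i, c i * f i y) ^ 2 := by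
  have hcont : ∀ c : Fin d → ℝ, Continuous fun y => ∑ i, c i * f i y := fun c => by fun_prop
  obtain ⟨B, hB⟩ : ∃ B, ∀ y ∈ K, ∑ i, |f i y| ≤ B := by
    obtain ⟨B, hB⟩ := (hK.image (f := fun y => ∑ i, |f i y|) (by fun_prop)).bddAbove
    exact ⟨B, fun y hy => hB ⟨y, hy, rfl⟩⟩
  -- uniformly over the coefficient sphere, sublevel sets for a small level have volume `< ρ / 2`
  have key : ∃ ε > 0, ∀ c ∈ Metric.sphere (0 : Fin d → ℝ) 1,
      volume.real {y ∈ K | |∑ i, c i * f i y| ≤ ε} ≤ ρ / 2 := by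
    refine (isCompact_sphere (0 : Fin d → ℝ) 1).induction_on
      (p := fun s => ∃ ε > 0, ∀ c ∈ s, volume.real {y ∈ K | |∑ i, c i * f i y| ≤ ε} ≤ ρ / 2)
      ⟨1, one_pos, by simp⟩ ?_ ?_ ?_
    · rintro s t hst ⟨ε, hε, h⟩
      exact ⟨ε, hε, fun c hc => h c (hst hc)⟩
    · rintro s t ⟨ε, hε, h⟩ ⟨ε', hε', h'⟩
      refine ⟨min ε ε', lt_min hε hε', ?_⟩
      rintro c (hc | hc)
      · refine le_trans (measureReal_mono ?_ ?_) (h c hc)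
        · exact fun y hy => ⟨hy.1, hy.2.trans (min_le_left _ _)⟩
        · exact ne_top_of_le_ne_top hK.measure_lt_top.ne (measure_mono (sep_subset _ _))
      · refine le_trans (measureReal_mono ?_ ?_) (h' c hc)
        · exact fun y hy => ⟨hy.1, hy.2.trans (min_le_right _ _)⟩
        · exact ne_top_of_le_ne_top hK.measure_lt_top.ne (measure_mono (sep_subset _ _))
    · intro c hc
      have hc0 : c ≠ 0 := by
        rintro rfl
        simp at hc
      set A : ℕ → Set E3 := fun n => {y ∈ K | |∑ i, c i * f i y| ≤ 1 / ((n : ℝ) + 1)} with hA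
      have hAm : ∀ n, MeasurableSet (A n) := fun n =>
        (hK.isClosed.inter (isClosed_le (hcont c).abs continuous_const)).measurableSet
      have hAfin : ∀ n, volume (A n) ≠ ⊤ := fun n =>
        ne_top_of_le_ne_top hK.measure_lt_top.ne (measure_mono (sep_subset _ _))
      have hanti : Antitone A := fun a b hab y hy =>
        ⟨hy.1, hy.2.trans (Nat.one_div_le_one_div hab)⟩
      have hlim := tendsto_measure_iInter_atTop (μ := volume)
        (fun n => (hAm n).nullMeasurableSet) hanti ⟨0, hAfin 0⟩
      have hz : volume (⋂ n, A n) = 0 := by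
        refine measure_mono_null ?_ (hnull c hc0)
        intro y hy
        rw [mem_iInter] at hy
        have : |∑ i, c i * f i y| ≤ 0 :=
          ge_of_tendsto' tendsto_one_div_add_atTop_nhds_zero_nat fun n => (hy n).2
        exact abs_nonpos_iff.1 this
      rw [hz] at hlim
      have hpos : (0 : ENNReal) < ENNReal.ofReal (ρ / 2) := by
        rw [ENNReal.ofReal_pos]; positivity
      obtain ⟨n, hn⟩ := (hlim.eventually_lt_const hpos).exists
      set ε : ℝ := 1 / ((n : ℝ) + 1) / 2 with hεdef
      have hε : 0 < ε := by positivity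
      have hB1 : 0 < |B| + 1 := by positivity
      refine ⟨Metric.ball c (ε / (|B| + 1)),
        mem_nhdsWithin_of_mem_nhds (Metric.ball_mem_nhds c (by positivity)), ε, hε, ?_⟩
      intro c' hc'
      have hsub : {y ∈ K | |∑ i, c' i * f i y| ≤ ε} ⊆ A n := by
        rintro y ⟨hy, hyε⟩
        refine ⟨hy, ?_⟩
        have h1 : |∑ i, c i * f i y - ∑ i, c' i * f i y| ≤ ε := by
          rw [← Finset.sum_sub_distrib]
          calc |∑ i, (c i * f i y - c' i * f i y)|
              ≤ ∑ i, |c i * f i y - c' i * f i y| := Finset.abs_sum_le_sum_abs _ _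
            _ ≤ ∑ i, ε / (|B| + 1) * |f i y| := by
                refine Finset.sum_le_sum fun i _ => ?_
                rw [← sub_mul, abs_mul]
                gcongr
                have h2 := norm_le_pi_norm (c - c') i
                rw [Metric.mem_ball, dist_comm, dist_eq_norm] at hc'
                simpa using h2.trans hc'.le
            _ = ε / (|B| + 1) * ∑ i, |f i y| := by rw [Finset.mul_sum]
            _ ≤ ε / (|B| + 1) * (|B| + 1) := by
                gcongr
                linarith [hB y hy, le_abs_self B]
            _ = ε := by field_simp
        have h2 : 1 / ((n : ℝ) + 1) = ε + ε := by rw [hεdef]; ring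
        rw [h2]
        have h3 := abs_add_le (∑ i, c i * f i y - ∑ i, c' i * f i y) (∑ i, c' i * f i y)
        rw [sub_add_cancel] at h3
        linarith
      refine (measureReal_mono hsub (hAfin n)).trans ?_
      exact ENNReal.toReal_le_of_le_ofReal (by positivity) hn.le
  obtain ⟨ε, hε, h⟩ := key
  refine ⟨ε ^ 2 * (ρ / 2), by positivity, fun c S hSK hS hρS => ?_⟩
  have hSfin : volume S ≠ ⊤ := ne_top_of_le_ne_top hK.measure_lt_top.ne (measure_mono hSK)
  have hint : ∀ c : Fin d → ℝ, IntegrableOn (fun y => (∑ i, c i * f i y) ^ 2) S := fun c =>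
    (((hcont c).pow 2).continuousOn.integrableOn_compact hK).mono_set hSK
  -- the case of unit coefficient norm
  have hunit : ∀ c ∈ Metric.sphere (0 : Fin d → ℝ) 1,
      ε ^ 2 * (ρ / 2) ≤ ∫ y in S, (∑ i, c i * f i y) ^ 2 := by
    intro c hc
    set Z := {y ∈ K | |∑ i, c i * f i y| ≤ ε} with hZ
    have hZm : MeasurableSet Z :=
      (hK.isClosed.inter (isClosed_le (hcont c).abs continuous_const)).measurableSet
    have hZfin : volume Z ≠ ⊤ :=
      ne_top_of_le_ne_top hK.measure_lt_top.ne (measure_mono (sep_subset _ _))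
    have hvol : ρ / 2 ≤ volume.real (S \ Z) := by
      have h1 := le_measureReal_sdiff (μ := volume) (s₁ := S) (s₂ := Z) hZfin
      linarith [h c hc]
    calc ε ^ 2 * (ρ / 2) ≤ ε ^ 2 * volume.real (S \ Z) := by gcongr
      _ ≤ ∫ y in S \ Z, (∑ i, c i * f i y) ^ 2 := by
          refine setIntegral_ge_of_const_le_real (hS.diff hZm)
            (ne_top_of_le_ne_top hSfin (measure_mono sdiff_subset)) ?_
            ((hint c).mono_set sdiff_subset)
          intro y hy
          have hy2 : ε < |∑ i, c i * f i y| := by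
            by_contra hcon
            exact hy.2 ⟨hSK hy.1, not_lt.1 hcon⟩
          rw [← sq_abs (∑ i, c i * f i y)]
          gcongr
      _ ≤ ∫ y in S, (∑ i, c i * f i y) ^ 2 :=
          setIntegral_mono_set (hint c) (Filter.Eventually.of_forall fun y => sq_nonneg _)
            (LE.le.eventuallyLE sdiff_subset)
  rcases eq_or_ne c 0 with rfl | hc
  · simp
  have hn : 0 < ‖c‖ := norm_pos_iff.2 hc
  have h1 := hunit (‖c‖⁻¹ • c) (by simp [norm_smul, hn.ne'])
  have h2 : ∀ y, (∑ i, c i * f i y) ^ 2 =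
      ‖c‖ ^ 2 * (∑ i, (‖c‖⁻¹ • c) i * f i y) ^ 2 := by
    intro y
    rw [← mul_pow, Finset.mul_sum]
    congr 1
    refine Finset.sum_congr rfl fun i _ => ?_
    simp only [Pi.smul_apply, smul_eq_mul]
    field_simp
  simp_rw [h2]
  rw [integral_const_mul, mul_comm]
  gcongr

theorem ev_add (p q : MvPolynomial (Fin 3) ℝ) (x : E3) : ev (p + q) x = ev p x + ev q x := by
  simp [ev]

theorem ev_sub (p q : MvPolynomial (Fin 3) ℝ) (x : E3) : ev (p - q) x = ev p x - ev q x := by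
  simp [ev]

theorem ev_smul (c : ℝ) (p : MvPolynomial (Fin 3) ℝ) (x : E3) : ev (c • p) x = c * ev p x := by
  simp [ev, MvPolynomial.smul_eval]

theorem ev_C (c : ℝ) (x : E3) : ev (MvPolynomial.C c) x = c := by
  simp [ev]

theorem ev_sum {ι : Type*} (s : Finset ι) (p : ι → MvPolynomial (Fin 3) ℝ) (x : E3) :
    ev (∑ i ∈ s, p i) x = ∑ i ∈ s, ev (p i) x := by
  simp [ev]

/-- On a set of volume at least `ρ` in the unit ball, the `L²` norm of a polynomial of degree at
most `r` controls its values and those of its first derivatives on the unit ball. -/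
theorem exists_sq_ev_le_unit (r : ℕ) {ρ : ℝ} (hρ : 0 < ρ) :
    ∃ C > 0, ∀ p : Poly r, ∀ S ⊆ Metric.closedBall (0 : E3) 1, MeasurableSet S →
      ρ ≤ volume.real S → ∀ y ∈ Metric.closedBall (0 : E3) 1,
      ev p y ^ 2 ≤ C * ∫ z in S, ev p z ^ 2 ∧
      ∀ i, ev (MvPolynomial.pderiv i p) y ^ 2 ≤ C * ∫ z in S, ev p z ^ 2 := by
  set b := Module.finBasis ℝ (Poly r) with hb
  set f : Fin (Module.finrank ℝ (Poly r)) → E3 → ℝ := fun i => ev (b i) with hf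
  have hcomb : ∀ c : Fin (Module.finrank ℝ (Poly r)) → ℝ,
      ((∑ i, c i • b i : Poly r) : MvPolynomial (Fin 3) ℝ) = ∑ i, c i • (b i).1 := by
    intro c; simp
  have hev : ∀ (c : Fin (Module.finrank ℝ (Poly r)) → ℝ) y,
      ev ((∑ i, c i • b i : Poly r) : MvPolynomial (Fin 3) ℝ) y = ∑ i, c i * f i y := by
    intro c y
    rw [hcomb, ev_sum]
    simp_rw [ev_smul, hf]
  have hK := isCompact_closedBall (0 : E3) 1
  obtain ⟨δ, hδ, h⟩ := exists_le_setIntegral_sq_sum f (fun i => continuous_ev _) hK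
    (fun c hc => by
      simp_rw [← hev]
      refine volume_zeroSet_ev ?_
      intro h0
      apply hc
      have h1 : (∑ i, c i • b i : Poly r) = 0 := Subtype.ext h0
      funext i
      exact (Fintype.linearIndependent_iff.1 b.linearIndependent) c h1 i) hρ
  -- a common bound on the ball for the basis functions and their first derivatives
  obtain ⟨B, hB⟩ : ∃ B, ∀ y ∈ Metric.closedBall (0 : E3) 1,
      ∑ i, |f i y| + ∑ j, ∑ i, |ev (MvPolynomial.pderiv j (b i).1) y| ≤ B := by
    obtain ⟨B, hB⟩ := (hK.image (f := fun y => ∑ i, |f i y| +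
      ∑ j, ∑ i, |ev (MvPolynomial.pderiv j (b i).1) y|) (by
        have h1 := fun i => continuous_ev (b i).1
        have h2 := fun i j => continuous_ev (MvPolynomial.pderiv j (b i).1)
        fun_prop)).bddAbove
    exact ⟨B, fun y hy => hB ⟨y, hy, rfl⟩⟩
  have hlin : ∀ (c : Fin (Module.finrank ℝ (Poly r)) → ℝ)
      (g : Fin (Module.finrank ℝ (Poly r)) → ℝ) (B : ℝ), ∑ i, |g i| ≤ B →
      (∑ i, c i * g i) ^ 2 ≤ B ^ 2 * ‖c‖ ^ 2 := by
    intro c g B hg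
    rw [← mul_pow, ← sq_abs (∑ i, c i * g i)]
    gcongr
    calc |∑ i, c i * g i| ≤ ∑ i, |c i * g i| := Finset.abs_sum_le_sum_abs _ _
      _ ≤ ∑ i, ‖c‖ * |g i| := by
          refine Finset.sum_le_sum fun i _ => ?_
          rw [abs_mul]
          gcongr
          exact norm_le_pi_norm c i
      _ = ‖c‖ * ∑ i, |g i| := by rw [Finset.mul_sum]
      _ ≤ B * ‖c‖ := by rw [mul_comm]; gcongr
  refine ⟨(B ^ 2 + 1) / δ, by positivity, fun p S hS hSm hvol y hy => ?_⟩
  set c : Fin (Module.finrank ℝ (Poly r)) → ℝ := ⇑(b.repr p) with hc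
  have hp : (∑ i, c i • b i) = p := b.sum_repr p
  have h1 := h c S hS hSm hvol
  have hBy := hB y hy
  have hn1 : 0 ≤ ∑ i, |f i y| := Finset.sum_nonneg fun _ _ => abs_nonneg _
  have hn2 : ∀ j, 0 ≤ ∑ i, |ev (MvPolynomial.pderiv j (b i).1) y| :=
    fun j => Finset.sum_nonneg fun _ _ => abs_nonneg _
  have hI : B ^ 2 * ‖c‖ ^ 2 ≤ (B ^ 2 + 1) / δ * ∫ z in S, ev p z ^ 2 := by
    have h2 : ∫ z in S, ev p z ^ 2 = ∫ z in S, (∑ i, c i * f i z) ^ 2 := by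
      simp_rw [← hev, hp]
    rw [h2]
    calc B ^ 2 * ‖c‖ ^ 2 ≤ (B ^ 2 + 1) / δ * (δ * ‖c‖ ^ 2) := by
          rw [← mul_assoc, div_mul_cancel₀ _ hδ.ne']
          gcongr
          linarith
      _ ≤ _ := by gcongr
  refine ⟨?_, fun j => ?_⟩
  · have h3 : ev p y = ∑ i, c i * f i y := by rw [← hev, hp]
    rw [h3]
    exact (hlin c _ B (by linarith [Finset.sum_nonneg fun j (_ : j ∈ Finset.univ) => hn2 j])).trans hI
  · have h3 : ev (MvPolynomial.pderiv j p.1) y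
        = ∑ i, c i * ev (MvPolynomial.pderiv j (b i).1) y := by
      conv_lhs => rw [← hp, hcomb, map_sum, ev_sum]
      simp_rw [Derivation.map_smul, ev_smul]
    rw [h3]
    refine (hlin c _ B ?_).trans hI
    have := Finset.single_le_sum (fun j _ => hn2 j) (Finset.mem_univ j)
    linarith

/-- Substitution of `x₀ + h y` for the variable of a polynomial. -/
noncomputable def affineSubst (x₀ : E3) (h : ℝ) :
    MvPolynomial (Fin 3) ℝ →ₐ[ℝ] MvPolynomial (Fin 3) ℝ :=
  MvPolynomial.aeval fun i => MvPolynomial.C (x₀ i) + MvPolynomial.C h * MvPolynomial.X i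

theorem ev_affineSubst (x₀ : E3) (h : ℝ) (p : MvPolynomial (Fin 3) ℝ) (y : E3) :
    ev (affineSubst x₀ h p) y = ev p (x₀ + h • y) := by
  induction p using MvPolynomial.induction_on with
  | C a => simp [affineSubst, ev]
  | add p q hp hq => rw [map_add, ev_add, ev_add, hp, hq]
  | mul_X p i hp =>
    have hmul : ∀ (p q : MvPolynomial (Fin 3) ℝ) x, ev (p * q) x = ev p x * ev q x := by
      simp [ev]
    rw [map_mul, hmul, hmul, hp]
    simp [affineSubst, ev]

theorem pderiv_affineSubst (x₀ : E3) (h : ℝ) (p : MvPolynomial (Fin 3) ℝ) (j : Fin 3) :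
    MvPolynomial.pderiv j (affineSubst x₀ h p)
      = h • affineSubst x₀ h (MvPolynomial.pderiv j p) := by
  induction p using MvPolynomial.induction_on with
  | C a => simp [affineSubst]
  | add p q hp hq => simp only [map_add, hp, hq, smul_add]
  | mul_X p i hp =>
    have hX : affineSubst x₀ h (MvPolynomial.X i)
        = MvPolynomial.C (x₀ i) + MvPolynomial.C h * MvPolynomial.X i := by simp [affineSubst]
    have hX' : affineSubst x₀ h ((Pi.single j 1 : Fin 3 → MvPolynomial (Fin 3) ℝ) i)
        = (Pi.single j 1 : Fin 3 → MvPolynomial (Fin 3) ℝ) i := by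
      rcases eq_or_ne i j with rfl | hij <;> simp [*]
    simp only [map_mul, Derivation.leibniz, hp, smul_eq_mul, map_add, MvPolynomial.pderiv_X, hX,
      MvPolynomial.pderiv_C, MvPolynomial.smul_eq_C_mul, hX']
    ring

theorem totalDegree_affineSubst_le (x₀ : E3) (h : ℝ) (p : MvPolynomial (Fin 3) ℝ) :
    (affineSubst x₀ h p).totalDegree ≤ p.totalDegree := by
  rw [affineSubst, MvPolynomial.aeval_def, MvPolynomial.eval₂_eq]
  refine (MvPolynomial.totalDegree_finsetSum _ _).trans (Finset.sup_le fun s hs => ?_)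
  refine (MvPolynomial.totalDegree_mul _ _).trans ?_
  have h1 : (algebraMap ℝ (MvPolynomial (Fin 3) ℝ) (p.coeff s)).totalDegree = 0 :=
    MvPolynomial.totalDegree_C _
  rw [h1, zero_add]
  refine (MvPolynomial.totalDegree_finsetProd _ _).trans ?_
  refine le_trans (Finset.sum_le_sum fun i _ => ?_) (MvPolynomial.le_totalDegree hs)
  refine (MvPolynomial.totalDegree_pow _ _).trans ?_
  refine mul_le_of_le_one_right (Nat.zero_le _) ?_
  refine (MvPolynomial.totalDegree_add _ _).trans (max_le ?_ ?_)
  · simp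
  · refine (MvPolynomial.totalDegree_mul _ _).trans ?_
    simp

theorem setIntegral_comp_affine {x₀ : E3} {h : ℝ} (hh : 0 < h) {T : Set E3}
    (hT : MeasurableSet T) (f : E3 → ℝ) :
    ∫ y in (fun y : E3 => x₀ + h • y) ⁻¹' T, f (x₀ + h • y) = (h ^ 3)⁻¹ * ∫ x in T, f x := by
  have hm : Measurable fun y : E3 => x₀ + h • y := by fun_prop
  rw [← integral_indicator (hm hT), ← integral_indicator hT]
  have h1 : ((fun y : E3 => x₀ + h • y) ⁻¹' T).indicator (fun y => f (x₀ + h • y))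
      = fun y => (fun z => T.indicator f (x₀ + z)) (h • y) := by
    ext y
    exact indicator_comp_right (g := f) (fun y : E3 => x₀ + h • y)
  rw [h1, Measure.integral_comp_smul volume (fun z => T.indicator f (x₀ + z)) h,
    integral_add_left_eq_self (μ := volume) (T.indicator f) x₀]
  simp [abs_of_pos hh]

/-- The local inverse estimates in pointwise form: on a set `T` of diameter comparable to `h` and
volume comparable to `h³`, the `L²(T)` norm of a polynomial controls its values and those of its
first derivatives, with the powers of `h` given by scaling. -/
theorem exists_sq_ev_le (r : ℕ) {ρ : ℝ} (hρ : 0 < ρ) :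
    ∃ C > 0, ∀ (p : Poly r) (x₀ : E3) (h : ℝ), 0 < h → ∀ T ⊆ Metric.closedBall x₀ h,
      MeasurableSet T → ρ * h ^ 3 ≤ volume.real T → ∀ x ∈ Metric.closedBall x₀ h,
      ev p x ^ 2 ≤ C / h ^ 3 * ∫ z in T, ev p z ^ 2 ∧
      ∀ i, ev (MvPolynomial.pderiv i p) x ^ 2 ≤ C / h ^ 5 * ∫ z in T, ev p z ^ 2 := by
  obtain ⟨C, hC, H⟩ := exists_sq_ev_le_unit r hρ
  refine ⟨C, hC, fun p x₀ h hh T hT hTm hvol x hx => ?_⟩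
  have hm : Measurable fun y : E3 => x₀ + h • y := by fun_prop
  set S := (fun y : E3 => x₀ + h • y) ⁻¹' T with hS
  have hball : ∀ y : E3, x₀ + h • y ∈ Metric.closedBall x₀ h → y ∈ Metric.closedBall (0 : E3) 1 := by
    intro y hy
    rw [mem_closedBall_iff_norm, add_sub_cancel_left, norm_smul, Real.norm_of_nonneg hh.le] at hy
    rw [mem_closedBall_zero_iff]
    exact le_of_mul_le_mul_left (by simpa using hy) hh
  have hSvol : ρ ≤ volume.real S := by
    have h1 := setIntegral_comp_affine (x₀ := x₀) hh hTm (fun _ => 1)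
    simp only [integral_const, MeasurableSet.univ, measureReal_restrict_apply, univ_inter,
      smul_eq_mul, mul_one] at h1
    rw [hS, h1, inv_mul_eq_div, le_div_iff₀ (by positivity)]
    exact hvol
  set p' : Poly r := ⟨affineSubst x₀ h p, by
    rw [MvPolynomial.mem_restrictTotalDegree]
    exact (totalDegree_affineSubst_le _ _ _).trans
      ((MvPolynomial.mem_restrictTotalDegree _ _ _).1 p.2)⟩ with hp'
  set y : E3 := h⁻¹ • (x - x₀) with hy
  have hxy : x₀ + h • y = x := by rw [hy, smul_inv_smul₀ hh.ne']; abel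
  have hyb : y ∈ Metric.closedBall (0 : E3) 1 := hball y (by rwa [hxy])
  obtain ⟨h1, h2⟩ := H p' S (fun z hz => hball z (hT hz)) (hm hTm) hSvol y hyb
  have hint : ∫ z in S, ev p' z ^ 2 = (h ^ 3)⁻¹ * ∫ z in T, ev p z ^ 2 := by
    rw [← setIntegral_comp_affine hh hTm (fun z => ev p z ^ 2)]
    simp_rw [hp', ev_affineSubst]
    rfl
  rw [hint] at h1 h2
  constructor
  · rw [hp'] at h1
    simp only [ev_affineSubst, hxy] at h1
    rw [div_eq_mul_inv, mul_assoc]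
    exact h1
  · intro i
    have h3 := h2 i
    rw [hp'] at h3
    simp only [pderiv_affineSubst, ev_smul, ev_affineSubst, hxy] at h3
    have h4 : C / h ^ 5 * ∫ z in T, ev p z ^ 2
        = (h ^ 2)⁻¹ * (C * ((h ^ 3)⁻¹ * ∫ z in T, ev p z ^ 2)) := by
      field_simp
    rw [h4, ← div_eq_inv_mul, le_div_iff₀ (by positivity), ← mul_pow, mul_comm]
    exact h3

/-! ### Integrals over cells and faces -/

theorem isCompact_sUnion_convexHull_range {m : ℕ} {T : Set E3} {S : Set (Set E3)} (hS : S.Finite)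
    (h : ∀ s ∈ S, ∃ p : Fin m → E3, AffineIndependent ℝ p ∧ s = convexHull ℝ (range p))
    (hT : T = ⋃₀ S) : IsCompact T := by
  rw [hT]
  refine hS.isCompact_sUnion fun s hs => ?_
  obtain ⟨p, -, rfl⟩ := h s hs
  exact (finite_range p).isCompact_convexHull ℝ

theorem IsPolyhedron.isCompact {T : Set E3} (h : IsPolyhedron T) : IsCompact T := by
  obtain ⟨-, S, hS, hS', hT⟩ := h
  exact isCompact_sUnion_convexHull_range hS hS' hT

theorem IsPolygon.isCompact {e : Set E3} (h : IsPolygon e) : IsCompact e := by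
  obtain ⟨-, -, S, hS, hS', he⟩ := h
  exact isCompact_sUnion_convexHull_range hS hS' he

theorem IsPolyhedron.diam_pos {T : Set E3} (h : IsPolyhedron T) : 0 < Metric.diam T := by
  refine Metric.diam_pos ?_ h.isCompact.isBounded
  by_contra hsub
  rw [not_nontrivial_iff] at hsub
  obtain ⟨x, hx⟩ := h.1.nonempty
  have h1 : interior T = {x} := (hsub.anti interior_subset).eq_singleton_of_mem hx
  have h2 : IsOpen ({x} : Set E3) := h1 ▸ isOpen_interior
  exact not_isOpen_singleton x h2

theorem volume_real_le_of_subset_closedBall {T : Set E3} {x : E3} {R : ℝ} (hR : 0 ≤ R)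
    (h : T ⊆ Metric.closedBall x R) :
    volume.real T ≤ volume.real (Metric.ball (0 : E3) 1) * R ^ 3 := by
  refine (measureReal_mono h measure_closedBall_lt_top.ne).trans ?_
  rw [measureReal_def, Measure.addHaar_closedBall _ _ hR]
  simp [measureReal_def, mul_comm, hR]

/-- A planar set in a ball of radius `R` has area at most that of a disc of radius `R`. -/
theorem euclideanHausdorffMeasure_two_le {e : Set E3} {n : E3} (hn : ‖n‖ = 1)
    (he : ∀ x ∈ e, ∀ y ∈ e, inner ℝ n (x - y) = 0) {x₀ : E3} (hx₀ : x₀ ∈ e) {R : ℝ} (hR : 0 ≤ R)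
    (h : e ⊆ Metric.closedBall x₀ R) :
    μHE[2] e ≤ ENNReal.ofReal (R ^ 2) * volume (Metric.ball (0 : EuclideanSpace ℝ (Fin 2)) 1) := by
  have hn0 : n ≠ 0 := by rintro rfl; simp at hn
  have hfin : Fact (Module.finrank ℝ E3 = 2 + 1) := ⟨by simp⟩
  have hV : Module.finrank ℝ (Submodule.span ℝ {n})ᗮ = 2 :=
    Submodule.finrank_orthogonal_span_singleton hn0
  let φ : (Submodule.span ℝ {n})ᗮ ≃ₗᵢ[ℝ] EuclideanSpace ℝ (Fin 2) :=
    (stdOrthonormalBasis ℝ (Submodule.span ℝ {n})ᗮ).reindex (finCongr hV) |>.repr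
  let F : EuclideanSpace ℝ (Fin 2) → E3 := fun y => x₀ + (φ.symm y : E3)
  have hF : Isometry F := by
    refine Isometry.of_dist_eq fun a b => ?_
    simp only [F, dist_add_left]
    rw [← φ.symm.dist_map a b]
    rfl
  have hsub : e ⊆ F '' Metric.closedBall 0 R := by
    intro x hx
    have hmem : x - x₀ ∈ (Submodule.span ℝ {n})ᗮ :=
      Submodule.mem_orthogonal_singleton_iff_inner_right.2 (he x hx x₀ hx₀)
    refine ⟨φ ⟨x - x₀, hmem⟩, ?_, by simp [F]⟩
    rw [mem_closedBall_zero_iff, φ.norm_map]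
    exact mem_closedBall_iff_norm.1 (h hx)
  calc μHE[2] e ≤ μHE[2] (F '' Metric.closedBall 0 R) := measure_mono hsub
    _ = μHE[2] (Metric.closedBall (0 : EuclideanSpace ℝ (Fin 2)) R) :=
        hF.euclideanHausdorffMeasure_image _
    _ = volume (Metric.closedBall (0 : EuclideanSpace ℝ (Fin 2)) R) := by
        rw [EuclideanSpace.euclideanHausdorffMeasure_eq_volume]
    _ = _ := by rw [Measure.addHaar_closedBall _ _ hR]; simp

theorem continuous_evVec {r : ℕ} (p : Fin 3 → Poly r) : Continuous (evVec p) :=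
  continuous_pi fun _ => continuous_ev _

theorem continuous_gradAt (p : MvPolynomial (Fin 3) ℝ) : Continuous (gradAt p) :=
  continuous_pi fun _ => continuous_ev _

theorem continuous_curlAt {r : ℕ} (p : Fin 3 → Poly r) : Continuous (curlAt p) := by
  have h := fun i j => (continuous_apply j).comp (continuous_gradAt (p i).1)
  refine continuous_pi fun i => ?_
  fin_cases i <;> simp only [curlAt]
  · exact (h 2 1).sub (h 1 2)
  · exact (h 0 2).sub (h 2 0)
  · exact (h 1 0).sub (h 0 1)

theorem continuous_crossProduct {f g : E3 → Fin 3 → ℝ} (hf : Continuous f) (hg : Continuous g) :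
    Continuous fun x => f x ⨯₃ g x := by
  have h1 := fun i => (continuous_apply i).comp hf
  have h2 := fun i => (continuous_apply i).comp hg
  refine continuous_pi fun i => ?_
  simp only [cross_apply]
  fin_cases i
  · exact ((h1 1).mul (h2 2)).sub ((h1 2).mul (h2 1))
  · exact ((h1 2).mul (h2 0)).sub ((h1 0).mul (h2 2))
  · exact ((h1 0).mul (h2 1)).sub ((h1 1).mul (h2 0))

namespace PolyMesh

variable {Ω : Set E3} {N M : ℕ} (𝒯 : PolyMesh Ω N M)

theorem isCompact_cell (T : Fin N) : IsCompact (𝒯.cell T) := (𝒯.polyhedron T).isCompact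

theorem isCompact_face (e : Fin M) : IsCompact (𝒯.face e) := (𝒯.polygon e).isCompact

theorem hT_pos (T : Fin N) : 0 < 𝒯.hT T := (𝒯.polyhedron T).diam_pos

theorem hT_le_h (T : Fin N) : 𝒯.hT T ≤ 𝒯.h := le_ciSup (finite_range 𝒯.hT).bddAbove T

theorem cell_subset_closedBall {T : Fin N} {x : E3} (hx : x ∈ 𝒯.cell T) :
    𝒯.cell T ⊆ Metric.closedBall x (𝒯.hT T) := fun _ hy =>
  Metric.dist_le_diam_of_mem (𝒯.isCompact_cell T).isBounded hy hx

theorem face_subset_cell {T : Fin N} {e : Fin M} (he : e ∈ 𝒯.facesOf T) :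
    𝒯.face e ⊆ 𝒯.cell T := by
  refine Subset.trans ?_ (𝒯.isCompact_cell T).isClosed.frontier_subset
  rw [𝒯.frontier_cell T]
  exact subset_biUnion_of_mem (u := 𝒯.face) (by simpa [facesOf] using he)

theorem left_mem_facesOf (e : Fin M) : e ∈ 𝒯.facesOf (𝒯.left e) := by simp [facesOf]

theorem area_face_le {T : Fin N} {e : Fin M} (he : e ∈ 𝒯.facesOf T) :
    μHE[2] (𝒯.face e) ≤ ENNReal.ofReal (𝒯.hT T ^ 2) *
      volume (Metric.ball (0 : EuclideanSpace ℝ (Fin 2)) 1) := by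
  obtain ⟨x, hx⟩ := (𝒯.polygon e).1.nonempty
  obtain ⟨hn, hp, -⟩ := 𝒯.normal_left e
  exact euclideanHausdorffMeasure_two_le hn hp hx (𝒯.hT_pos T).le
    ((𝒯.face_subset_cell he).trans (𝒯.cell_subset_closedBall (𝒯.face_subset_cell he hx)))

theorem area_face_lt_top (e : Fin M) : μHE[2] (𝒯.face e) < ⊤ :=
  (𝒯.area_face_le (𝒯.left_mem_facesOf e)).trans_lt
    (ENNReal.mul_lt_top ENNReal.ofReal_lt_top measure_ball_lt_top)

theorem integrableOn_cell (T : Fin N) {f : E3 → ℝ} (hf : Continuous f) :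
    IntegrableOn f (𝒯.cell T) :=
  hf.continuousOn.integrableOn_compact (𝒯.isCompact_cell T)

theorem integrableOn_face (e : Fin M) {f : E3 → ℝ} (hf : Continuous f) :
    IntegrableOn f (𝒯.face e) μHE[2] := by
  obtain ⟨C, hC⟩ := (𝒯.isCompact_face e).exists_bound_of_continuousOn hf.continuousOn
  exact IntegrableOn.of_bound (𝒯.area_face_lt_top e)
    hf.aestronglyMeasurable C
    (ae_restrict_of_forall_mem (𝒯.isCompact_face e).measurableSet hC)

theorem cellInt_add (T : Fin N) {f g : E3 → ℝ} (hf : Continuous f) (hg : Continuous g) :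
    𝒯.cellInt T (fun x => f x + g x) = 𝒯.cellInt T f + 𝒯.cellInt T g :=
  integral_add (𝒯.integrableOn_cell T hf) (𝒯.integrableOn_cell T hg)

theorem cellInt_const_mul (T : Fin N) (c : ℝ) (f : E3 → ℝ) :
    𝒯.cellInt T (fun x => c * f x) = c * 𝒯.cellInt T f :=
  integral_const_mul c f

theorem cellInt_sum {ι : Type*} (s : Finset ι) (T : Fin N) {f : ι → E3 → ℝ}
    (hf : ∀ i, Continuous (f i)) :
    𝒯.cellInt T (fun x => ∑ i ∈ s, f i x) = ∑ i ∈ s, 𝒯.cellInt T (f i) :=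
  integral_finsetSum s fun i _ => 𝒯.integrableOn_cell T (hf i)

theorem cellInt_mono (T : Fin N) {f g : E3 → ℝ} (hf : Continuous f) (hg : Continuous g)
    (h : ∀ x ∈ 𝒯.cell T, f x ≤ g x) : 𝒯.cellInt T f ≤ 𝒯.cellInt T g :=
  setIntegral_mono_on (𝒯.integrableOn_cell T hf) (𝒯.integrableOn_cell T hg)
    (𝒯.isCompact_cell T).measurableSet h

theorem cellInt_nonneg (T : Fin N) {f : E3 → ℝ} (h : ∀ x, 0 ≤ f x) : 0 ≤ 𝒯.cellInt T f :=
  integral_nonneg h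

theorem faceInt_add (e : Fin M) {f g : E3 → ℝ} (hf : Continuous f) (hg : Continuous g) :
    𝒯.faceInt e (fun x => f x + g x) = 𝒯.faceInt e f + 𝒯.faceInt e g :=
  integral_add (𝒯.integrableOn_face e hf) (𝒯.integrableOn_face e hg)

theorem faceInt_const_mul (e : Fin M) (c : ℝ) (f : E3 → ℝ) :
    𝒯.faceInt e (fun x => c * f x) = c * 𝒯.faceInt e f :=
  integral_const_mul c f

theorem faceInt_sum {ι : Type*} (s : Finset ι) (e : Fin M) {f : ι → E3 → ℝ}
    (hf : ∀ i, Continuous (f i)) :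
    𝒯.faceInt e (fun x => ∑ i ∈ s, f i x) = ∑ i ∈ s, 𝒯.faceInt e (f i) :=
  integral_finsetSum s fun i _ => 𝒯.integrableOn_face e (hf i)

theorem faceInt_mono (e : Fin M) {f g : E3 → ℝ} (hf : Continuous f) (hg : Continuous g)
    (h : ∀ x ∈ 𝒯.face e, f x ≤ g x) : 𝒯.faceInt e f ≤ 𝒯.faceInt e g :=
  setIntegral_mono_on (𝒯.integrableOn_face e hf) (𝒯.integrableOn_face e hg)
    (𝒯.isCompact_face e).measurableSet h

theorem faceInt_nonneg (e : Fin M) {f : E3 → ℝ} (h : ∀ x, 0 ≤ f x) : 0 ≤ 𝒯.faceInt e f :=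
  integral_nonneg h

theorem bdryInt_add (T : Fin N) {f g : Fin M → (Fin 3 → ℝ) → E3 → ℝ}
    (hf : ∀ e n, Continuous (f e n)) (hg : ∀ e n, Continuous (g e n)) :
    𝒯.bdryInt T (fun e n x => f e n x + g e n x) = 𝒯.bdryInt T f + 𝒯.bdryInt T g := by
  simp only [bdryInt]
  rw [← Finset.sum_add_distrib]
  exact Finset.sum_congr rfl fun e _ => 𝒯.faceInt_add e (hf _ _) (hg _ _)

theorem bdryInt_const_mul (T : Fin N) (c : ℝ) (f : Fin M → (Fin 3 → ℝ) → E3 → ℝ) :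
    𝒯.bdryInt T (fun e n x => c * f e n x) = c * 𝒯.bdryInt T f := by
  simp only [bdryInt]
  rw [Finset.mul_sum]
  exact Finset.sum_congr rfl fun e _ => 𝒯.faceInt_const_mul e c _

/-! ### Trace and inverse inequalities on a shape-regular mesh -/

/-- The trace inequality follows from the pointwise inverse estimate, since a face of an element
has area at most a multiple of the square of the diameter of the element. -/
theorem exists_trace_inverse_le (r : ℕ) {ρ : ℝ} (hρ : 0 < ρ) :
    ∃ C > 0, ∀ (Ω : Set E3) (N M n : ℕ) (𝒯 : PolyMesh Ω N M), 𝒯.ShapeRegular ρ n →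
      ∀ (T : Fin N) (p : Poly r),
      (∀ e ∈ 𝒯.facesOf T, 𝒯.faceInt e (fun x => ev p x ^ 2)
        ≤ C / 𝒯.hT T * 𝒯.cellInt T (fun x => ev p x ^ 2)) ∧
      ∀ i, 𝒯.cellInt T (fun x => ev (MvPolynomial.pderiv i p) x ^ 2)
        ≤ C / 𝒯.hT T ^ 2 * 𝒯.cellInt T (fun x => ev p x ^ 2) := by
  obtain ⟨C, hC, H⟩ := exists_sq_ev_le r hρ
  set A₂ := volume.real (Metric.ball (0 : EuclideanSpace ℝ (Fin 2)) 1) with hA₂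
  set A₃ := volume.real (Metric.ball (0 : E3) 1) with hA₃
  have h2 : 0 ≤ A₂ := measureReal_nonneg
  have h3 : 0 ≤ A₃ := measureReal_nonneg
  refine ⟨C * (A₂ + A₃ + 1), by positivity, fun Ω N M n 𝒯 hreg T p => ?_⟩
  have hT := 𝒯.hT_pos T
  have hc := 𝒯.isCompact_cell T
  set I := 𝒯.cellInt T (fun x => ev p x ^ 2) with hI
  have hI0 : 0 ≤ I := 𝒯.cellInt_nonneg T fun x => sq_nonneg _
  have hpt : ∀ x ∈ 𝒯.cell T, ev p x ^ 2 ≤ C / 𝒯.hT T ^ 3 * I ∧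
      ∀ i, ev (MvPolynomial.pderiv i p) x ^ 2 ≤ C / 𝒯.hT T ^ 5 * I := fun x hx =>
    H p x (𝒯.hT T) hT (𝒯.cell T) (𝒯.cell_subset_closedBall hx) hc.measurableSet
      (hreg.volume_ge T) x (Metric.mem_closedBall_self hT.le)
  constructor
  · intro e he
    have harea : (μHE[2] : Measure E3).real (𝒯.face e) ≤ 𝒯.hT T ^ 2 * A₂ := by
      have h4 := ENNReal.toReal_mono (ENNReal.mul_lt_top ENNReal.ofReal_lt_top
        measure_ball_lt_top).ne (𝒯.area_face_le he)
      rwa [ENNReal.toReal_mul, ENNReal.toReal_ofReal (by positivity)] at h4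
    calc 𝒯.faceInt e (fun x => ev p x ^ 2)
        ≤ 𝒯.faceInt e (fun _ => C / 𝒯.hT T ^ 3 * I) :=
          𝒯.faceInt_mono e ((continuous_ev _).pow 2) continuous_const
            fun x hx => (hpt x (𝒯.face_subset_cell he hx)).1
      _ = (μHE[2] : Measure E3).real (𝒯.face e) * (C / 𝒯.hT T ^ 3 * I) := by
          simp [faceInt]
      _ ≤ 𝒯.hT T ^ 2 * A₂ * (C / 𝒯.hT T ^ 3 * I) := by gcongr
      _ = C * A₂ / 𝒯.hT T * I := by field_simp
      _ ≤ _ := by gcongr; linarith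
  · intro i
    have hvol : volume.real (𝒯.cell T) ≤ A₃ * 𝒯.hT T ^ 3 := by
      obtain ⟨x, hx⟩ := (𝒯.polyhedron T).1.nonempty
      exact volume_real_le_of_subset_closedBall hT.le
        (𝒯.cell_subset_closedBall (interior_subset hx))
    calc 𝒯.cellInt T (fun x => ev (MvPolynomial.pderiv i p) x ^ 2)
        ≤ 𝒯.cellInt T (fun _ => C / 𝒯.hT T ^ 5 * I) :=
          𝒯.cellInt_mono T ((continuous_ev _).pow 2) continuous_const
            fun x hx => (hpt x hx).2 i
      _ = volume.real (𝒯.cell T) * (C / 𝒯.hT T ^ 5 * I) := by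
          simp [cellInt]
      _ ≤ A₃ * 𝒯.hT T ^ 3 * (C / 𝒯.hT T ^ 5 * I) := by gcongr
      _ = C * A₃ / 𝒯.hT T ^ 2 * I := by field_simp
      _ ≤ _ := by gcongr; linarith

/-! ### Existence of the weak divergence and the weak curl -/

theorem eq_zero_of_cellInt_sq_eq_zero {r : ℕ} (T : Fin N) (p : Poly r)
    (h : 𝒯.cellInt T (fun x => ev p x * ev p x) = 0) : p = 0 := by
  by_contra hp
  have hp' : (p : MvPolynomial (Fin 3) ℝ) ≠ 0 := fun h0 => hp (Subtype.ext h0)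
  have h1 : (fun x => ev p x * ev p x) =ᵐ[volume.restrict (𝒯.cell T)] 0 :=
    (integral_eq_zero_iff_of_nonneg (fun x => mul_self_nonneg _)
      (𝒯.integrableOn_cell T ((continuous_ev _).mul (continuous_ev _)))).1 h
  have h2 : ∀ᵐ x ∂volume.restrict (𝒯.cell T), ev p x ≠ 0 := by
    refine ae_restrict_of_ae ?_
    rw [ae_iff]
    simpa using volume_zeroSet_ev hp'
  have h3 : ∀ᵐ x ∂volume.restrict (𝒯.cell T), False := by
    filter_upwards [h1, h2] with x hx hx'
    exact hx' (mul_self_eq_zero.1 hx)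
  rw [Filter.eventually_false_iff_eq_bot, ae_eq_bot, Measure.restrict_eq_zero] at h3
  have h4 := (𝒯.polyhedron T).1.nonempty
  exact ((isOpen_interior.measure_pos volume h4).trans_le (measure_mono interior_subset)).ne' h3

/-- Riesz representation in `P_r` with the inner product of `L²(T)`. -/
theorem exists_riesz {r : ℕ} (T : Fin N) (F : Poly r →ₗ[ℝ] ℝ) :
    ∃ d : Poly r, ∀ φ : Poly r, 𝒯.cellInt T (fun x => ev d x * ev φ x) = F φ := by
  let B : Poly r →ₗ[ℝ] Module.Dual ℝ (Poly r) := LinearMap.mk₂ ℝ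
    (fun p q => 𝒯.cellInt T fun x => ev p x * ev q x)
    (fun p p' q => by
      simp only [Submodule.coe_add, ev_add, add_mul]
      exact 𝒯.cellInt_add T ((continuous_ev _).mul (continuous_ev _))
        ((continuous_ev _).mul (continuous_ev _)))
    (fun c p q => by
      simp only [Submodule.coe_smul, ev_smul, mul_assoc]
      exact 𝒯.cellInt_const_mul T c _)
    (fun p q q' => by
      simp only [Submodule.coe_add, ev_add, mul_add]
      exact 𝒯.cellInt_add T ((continuous_ev _).mul (continuous_ev _))
        ((continuous_ev _).mul (continuous_ev _)))
    (fun c p q => by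
      simp only [Submodule.coe_smul, ev_smul, mul_left_comm _ c]
      exact 𝒯.cellInt_const_mul T c _)
  have hB : Function.Injective B := by
    rw [← LinearMap.ker_eq_bot, LinearMap.ker_eq_bot']
    intro p hp
    exact 𝒯.eq_zero_of_cellInt_sq_eq_zero T p (LinearMap.congr_fun hp p)
  obtain ⟨d, hd⟩ := (LinearMap.injective_iff_surjective_of_finrank_eq_finrank
    Subspace.dual_finrank_eq.symm).1 hB F
  exact ⟨d, fun φ => LinearMap.congr_fun hd φ⟩

theorem exists_riesz_vec {r : ℕ} (T : Fin N) (F : (Fin 3 → Poly r) →ₗ[ℝ] ℝ) :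
    ∃ c : Fin 3 → Poly r, ∀ φ : Fin 3 → Poly r,
      𝒯.cellInt T (fun x => evVec c x ⬝ᵥ evVec φ x) = F φ := by
  choose c hc using fun i => 𝒯.exists_riesz T (F ∘ₗ LinearMap.single ℝ (fun _ => Poly r) i)
  refine ⟨c, fun φ => ?_⟩
  simp only [dotProduct, evVec]
  rw [𝒯.cellInt_sum _ T (f := fun i x => ev (c i) x * ev (φ i) x)
    fun i => (continuous_ev _).mul (continuous_ev _)]
  simp_rw [hc, LinearMap.comp_apply]
  rw [← map_sum]
  congr 1
  exact LinearMap.sum_single_apply _ φ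

variable {k : ℕ}

theorem isWeakDiv_weakDiv (μ : Fin N → Matrix (Fin 3) (Fin 3) ℝ) (v : VSpace k N M) (T : Fin N) :
    𝒯.IsWeakDiv μ v T (𝒯.weakDiv μ v T) := by
  apply Classical.epsilon_spec
  have hg := fun φ : Poly (k - 1) => (continuous_const (y := μ T)).matrix_mulVec
    (continuous_evVec (v.inner T)) |>.dotProduct (continuous_gradAt φ.1)
  have hb := fun (φ : Poly (k - 1)) (e : Fin M) (n : Fin 3 → ℝ) =>
    show Continuous fun x => (evVec (v.bdry e) x ⬝ᵥ n) * ev φ.1 x from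
      ((continuous_evVec (v.bdry e)).dotProduct continuous_const).mul (continuous_ev φ.1)
  have hgrad_add : ∀ (φ ψ : MvPolynomial (Fin 3) ℝ) x,
      gradAt (φ + ψ) x = gradAt φ x + gradAt ψ x := by
    intro φ ψ x; ext i; simp [gradAt, ev_add]
  have hgrad_smul : ∀ (a : ℝ) (φ : MvPolynomial (Fin 3) ℝ) x,
      gradAt (a • φ) x = a • gradAt φ x := by
    intro a φ x; ext i; simp [gradAt, ev_smul]
  let F : Poly (k - 1) →ₗ[ℝ] ℝ :=
    { toFun := fun φ => -𝒯.cellInt T (fun x => (μ T *ᵥ evVec (v.inner T) x) ⬝ᵥ gradAt φ x) +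
        𝒯.bdryInt T (fun e n x => (evVec (v.bdry e) x ⬝ᵥ n) * ev φ x)
      map_add' := fun φ ψ => by
        simp only [Submodule.coe_add, ev_add, hgrad_add, dotProduct_add, mul_add]
        rw [𝒯.cellInt_add T (hg φ) (hg ψ), 𝒯.bdryInt_add T (hb φ) (hb ψ)]
        ring
      map_smul' := fun a φ => by
        simp only [Submodule.coe_smul, ev_smul, hgrad_smul, dotProduct_smul, smul_eq_mul,
          mul_left_comm _ a, RingHom.id_apply]
        rw [𝒯.cellInt_const_mul, 𝒯.bdryInt_const_mul]
        ring }
  exact 𝒯.exists_riesz T F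

theorem isWeakCurl_weakCurl (v : VSpace k N M) (T : Fin N) :
    𝒯.IsWeakCurl v T (𝒯.weakCurl v T) := by
  apply Classical.epsilon_spec
  have hg := fun φ : Fin 3 → Poly (k - 1) =>
    (continuous_evVec (v.inner T)).dotProduct (continuous_curlAt φ)
  have hb := fun (φ : Fin 3 → Poly (k - 1)) (e : Fin M) (n : Fin 3 → ℝ) =>
    (continuous_crossProduct (continuous_evVec (v.bdry e)) (continuous_const (y := n))).dotProduct
      (continuous_evVec φ)
  have hev_add : ∀ (φ ψ : Fin 3 → Poly (k - 1)) x,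
      evVec (φ + ψ) x = evVec φ x + evVec ψ x := by
    intro φ ψ x; ext i; simp [evVec, ev_add]
  have hev_smul : ∀ (a : ℝ) (φ : Fin 3 → Poly (k - 1)) x, evVec (a • φ) x = a • evVec φ x := by
    intro a φ x; ext i; simp [evVec, ev_smul]
  have hcurl_add : ∀ (φ ψ : Fin 3 → Poly (k - 1)) x,
      curlAt (φ + ψ) x = curlAt φ x + curlAt ψ x := by
    intro φ ψ x; ext i
    fin_cases i <;> simp [curlAt, gradAt, ev_add] <;> ring
  have hcurl_smul : ∀ (a : ℝ) (φ : Fin 3 → Poly (k - 1)) x,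
      curlAt (a • φ) x = a • curlAt φ x := by
    intro a φ x; ext i
    fin_cases i <;> simp [curlAt, gradAt, ev_smul] <;> ring
  let F : (Fin 3 → Poly (k - 1)) →ₗ[ℝ] ℝ :=
    { toFun := fun φ => 𝒯.cellInt T (fun x => evVec (v.inner T) x ⬝ᵥ curlAt φ x) -
        𝒯.bdryInt T (fun e n x => (evVec (v.bdry e) x ⨯₃ n) ⬝ᵥ evVec φ x)
      map_add' := fun φ ψ => by
        simp only [hev_add, hcurl_add, dotProduct_add]
        rw [𝒯.cellInt_add T (hg φ) (hg ψ), 𝒯.bdryInt_add T (hb φ) (hb ψ)]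
        ring
      map_smul' := fun a φ => by
        simp only [hev_smul, hcurl_smul, dotProduct_smul, smul_eq_mul, RingHom.id_apply]
        rw [𝒯.cellInt_const_mul, 𝒯.bdryInt_const_mul]
        ring }
  exact 𝒯.exists_riesz_vec T F

end PolyMesh

/-! ### The test function -/

theorem Poly.mono {r s : ℕ} (h : r ≤ s) {p : MvPolynomial (Fin 3) ℝ}
    (hp : p ∈ MvPolynomial.restrictTotalDegree (Fin 3) ℝ r) :
    p ∈ MvPolynomial.restrictTotalDegree (Fin 3) ℝ s := by
  rw [MvPolynomial.mem_restrictTotalDegree] at hp ⊢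
  exact hp.trans h

theorem pderiv_mem_restrictTotalDegree {r : ℕ} {p : MvPolynomial (Fin 3) ℝ}
    (hp : p ∈ MvPolynomial.restrictTotalDegree (Fin 3) ℝ r) (i : Fin 3) :
    MvPolynomial.pderiv i p ∈ MvPolynomial.restrictTotalDegree (Fin 3) ℝ r := by
  rw [MvPolynomial.mem_restrictTotalDegree] at hp
  rw [p.as_sum, map_sum]
  refine Submodule.sum_mem _ fun s hs => ?_
  rw [MvPolynomial.pderiv_monomial, MvPolynomial.mem_restrictTotalDegree]
  refine (MvPolynomial.totalDegree_monomial_le _ _).trans (le_trans ?_ hp)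
  refine le_trans ?_ (MvPolynomial.le_totalDegree hs)
  exact Finsupp.sum_le_sum_index tsub_le_self (fun _ _ _ _ h => h) (fun _ _ => rfl)

namespace PolyMesh

variable {Ω : Set E3} {N M : ℕ} (𝒯 : PolyMesh Ω N M) {k : ℕ}

/-- The test function `{-h² ∇q, g n_e}`, whose boundary part is normal to each face, with the
prescribed normal component `g` with respect to the orientation of the face. -/
noncomputable def testFun (q : WSpace k N) (g : Fin M → Poly k) : VSpace k N M where
  inner T i := (-𝒯.h ^ 2) • ⟨MvPolynomial.pderiv i (q T).1,
    pderiv_mem_restrictTotalDegree (Poly.mono (Nat.sub_le k 1) (q T).2) i⟩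
  bdry e i := 𝒯.normal e i • g e

theorem evVec_inner_testFun (q : WSpace k N) (g : Fin M → Poly k) (T : Fin N) (x : E3) :
    evVec ((𝒯.testFun q g).inner T) x = (-𝒯.h ^ 2) • gradAt (q T) x := by
  ext i
  simp only [evVec, testFun, Submodule.coe_smul, ev_smul, gradAt, Pi.smul_apply, smul_eq_mul]

theorem evVec_bdry_testFun (q : WSpace k N) (g : Fin M → Poly k) (e : Fin M) (x : E3) :
    evVec ((𝒯.testFun q g).bdry e) x = ev (g e) x • (𝒯.normal e).ofLp := by
  ext i
  simp only [evVec, testFun, Submodule.coe_smul, ev_smul, Pi.smul_apply, smul_eq_mul]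
  ring

theorem normal_dotProduct_self (e : Fin M) :
    (𝒯.normal e).ofLp ⬝ᵥ (𝒯.normal e).ofLp = 1 := by
  have h := EuclideanSpace.real_norm_sq_eq (𝒯.normal e)
  rw [(𝒯.normal_left e).1] at h
  rw [dotProduct, ← one_pow 2, h]
  exact Finset.sum_congr rfl fun i _ => (sq _).symm

theorem outNormal_left (e : Fin M) : 𝒯.outNormal (𝒯.left e) e = 𝒯.normal e := by
  simp [outNormal]

theorem outNormal_right {e : Fin M} {T : Fin N} (h : 𝒯.right e = some T) :
    𝒯.outNormal T e = -𝒯.normal e := by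
  have : 𝒯.left e ≠ T := fun h' => 𝒯.right_ne_left e (by rw [h, h'])
  simp [outNormal, this]

theorem outNormal_eq_or (T : Fin N) (e : Fin M) :
    (𝒯.outNormal T e).ofLp = (𝒯.normal e).ofLp ∨ (𝒯.outNormal T e).ofLp = -(𝒯.normal e).ofLp := by
  unfold outNormal
  split_ifs <;> simp

theorem outNormal_dotProduct_self (T : Fin N) (e : Fin M) :
    (𝒯.outNormal T e).ofLp ⬝ᵥ (𝒯.outNormal T e).ofLp = 1 := by
  rcases 𝒯.outNormal_eq_or T e with h | h <;> simp [h, 𝒯.normal_dotProduct_self e]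

theorem bdry_testFun_cross (q : WSpace k N) (g : Fin M → Poly k) (T : Fin N) (e : Fin M)
    (x : E3) :
    evVec ((𝒯.testFun q g).bdry e) x ⨯₃ (𝒯.outNormal T e).ofLp = 0 := by
  rw [evVec_bdry_testFun]
  rcases 𝒯.outNormal_eq_or T e with h | h <;> simp [h, cross_self]

/-- A sum over the faces of all elements visits each face from its left element, and each interior
face once more from its right element. -/
theorem sum_facesOf (F : Fin N → Fin M → ℝ) :
    ∑ T, ∑ e ∈ 𝒯.facesOf T, F T e
      = ∑ e, (F (𝒯.left e) e + (𝒯.right e).elim 0 fun T => F T e) := by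
  simp only [facesOf, Finset.sum_filter]
  rw [Finset.sum_comm]
  refine Finset.sum_congr rfl fun e _ => ?_
  have hsplit : ∀ T, (if 𝒯.left e = T ∨ 𝒯.right e = some T then F T e else 0)
      = (if 𝒯.left e = T then F T e else 0) + if 𝒯.right e = some T then F T e else 0 := by
    intro T
    by_cases h1 : 𝒯.left e = T
    · have h2 : 𝒯.right e ≠ some T := h1 ▸ 𝒯.right_ne_left e
      simp [h1, h2]
    · simp [h1]
  simp_rw [hsplit]
  rw [Finset.sum_add_distrib]
  congr 1
  · simp
  · rcases 𝒯.right e with _ | T <;> simp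

theorem b_testFun (μ : Fin N → Matrix (Fin 3) (Fin 3) ℝ) (q : WSpace k N) (g : Fin M → Poly k) :
    𝒯.b μ (𝒯.testFun q g) q =
      𝒯.h ^ 2 * ∑ T, 𝒯.cellInt T (fun x => (μ T *ᵥ gradAt (q T) x) ⬝ᵥ gradAt (q T) x) +
        ∑ e, 𝒯.faceInt e (fun x => ev (g e) x * 𝒯.jump q e x) := by
  have hT : ∀ T, 𝒯.cellInt T (fun x => ev (𝒯.weakDiv μ (𝒯.testFun q g) T) x * ev (q T) x)
      = 𝒯.h ^ 2 * 𝒯.cellInt T (fun x => (μ T *ᵥ gradAt (q T) x) ⬝ᵥ gradAt (q T) x) +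
        ∑ e ∈ 𝒯.facesOf T, ((𝒯.normal e).ofLp ⬝ᵥ (𝒯.outNormal T e).ofLp) *
          𝒯.faceInt e (fun x => ev (g e) x * ev (q T) x) := by
    intro T
    rw [𝒯.isWeakDiv_weakDiv μ (𝒯.testFun q g) T (q T)]
    congr 1
    · simp only [evVec_inner_testFun, Matrix.mulVec_smul, smul_dotProduct, smul_eq_mul]
      rw [𝒯.cellInt_const_mul]
      ring
    · simp only [bdryInt]
      refine Finset.sum_congr rfl fun e _ => ?_
      rw [← 𝒯.faceInt_const_mul]
      simp only [evVec_bdry_testFun, smul_dotProduct, smul_eq_mul]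
      congr 1
      ext x
      ring
  rw [b, Finset.sum_congr rfl fun T _ => hT T, Finset.sum_add_distrib, ← Finset.mul_sum,
    𝒯.sum_facesOf]
  congr 1
  refine Finset.sum_congr rfl fun e _ => ?_
  rw [outNormal_left, normal_dotProduct_self, one_mul]
  rcases h : 𝒯.right e with _ | T
  · simp [jump, h]
  · simp only [Option.elim, jump, h, 𝒯.outNormal_right h, WithLp.ofLp_neg, dotProduct_neg,
      normal_dotProduct_self]
    rw [← 𝒯.faceInt_const_mul, ← 𝒯.faceInt_add e (f := fun x => ev (g e) x * ev (q (𝒯.left e)) x)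
      (g := fun x => -1 * (ev (g e) x * ev (q T) x))
      ((continuous_ev (g e).1).mul (continuous_ev (q (𝒯.left e)).1))
      (continuous_const.mul ((continuous_ev (g e).1).mul (continuous_ev (q T).1)))]
    congr 1
    ext x
    ring

end PolyMesh

/-! ### The energy seminorm of the test function -/

/-- The operator norm bound `|A ξ| ≤ Λ |ξ|`, without spectral theory. -/
theorem IsSymmBetween.mulVec_sq_le {α Λ : ℝ} {A : Matrix (Fin 3) (Fin 3) ℝ} (hα : 0 < α)
    (h : IsSymmBetween α Λ A) (ξ : Fin 3 → ℝ) :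
    (A *ᵥ ξ) ⬝ᵥ (A *ᵥ ξ) ≤ Λ ^ 2 * (ξ ⬝ᵥ ξ) := by
  obtain ⟨hA, hb⟩ := h
  have hnn : ∀ η : Fin 3 → ℝ, 0 ≤ η ⬝ᵥ η := fun η => by
    simpa using dotProduct_star_self_nonneg η
  rcases eq_or_ne ξ 0 with rfl | hξ
  · simp
  have hξ' : 0 < ξ ⬝ᵥ ξ := lt_of_le_of_ne (hnn ξ) fun h0 => hξ (dotProduct_self_eq_zero.1 h0.symm)
  have hΛ : 0 < Λ := by
    have h1 := (hb ξ).1.trans (hb ξ).2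
    exact hα.trans_le (le_of_mul_le_mul_right h1 hξ')
  set η := A *ᵥ ξ with hη
  have hsymm : ξ ⬝ᵥ (A *ᵥ η) = η ⬝ᵥ η := by
    rw [Matrix.dotProduct_mulVec, ← Matrix.mulVec_transpose, hA.eq]
  -- the quadratic form of `A` at `Λ ξ - A ξ` is nonnegative
  have h2 := (mul_nonneg hα.le (hnn (Λ • ξ - η))).trans (hb (Λ • ξ - η)).1
  have h3 : (Λ • ξ - η) ⬝ᵥ (A *ᵥ (Λ • ξ - η))
      = Λ ^ 2 * (ξ ⬝ᵥ η) - 2 * Λ * (η ⬝ᵥ η) + η ⬝ᵥ (A *ᵥ η) := by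
    simp only [Matrix.mulVec_sub, Matrix.mulVec_smul, sub_dotProduct, dotProduct_sub,
      smul_dotProduct, dotProduct_smul, smul_eq_mul, hsymm, ← hη]
    ring
  rw [h3] at h2
  have h4 := (hb η).2
  have h5 := (hb ξ).2
  rw [← hη] at h5
  have h6 : Λ * (η ⬝ᵥ η) ≤ Λ * (Λ ^ 2 * (ξ ⬝ᵥ ξ)) := by
    have := mul_le_mul_of_nonneg_left h5 (sq_nonneg Λ)
    nlinarith
  exact le_of_mul_le_mul_left h6 hΛ

theorem sq_dotProduct_le (u w : Fin 3 → ℝ) : (u ⬝ᵥ w) ^ 2 ≤ (u ⬝ᵥ u) * (w ⬝ᵥ w) := by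
  simp only [dotProduct, ← sq]
  exact Finset.sum_mul_sq_le_sq_mul_sq _ _ _

theorem cross_dotProduct_cross_le (u w : Fin 3 → ℝ) :
    (u ⨯₃ w) ⬝ᵥ (u ⨯₃ w) ≤ (u ⬝ᵥ u) * (w ⬝ᵥ w) := by
  rw [cross_dot_cross, dotProduct_comm w u]
  linarith [mul_self_nonneg (u ⬝ᵥ w)]

theorem curlAt_sq_le {r : ℕ} (p : Fin 3 → Poly r) (x : E3) :
    curlAt p x ⬝ᵥ curlAt p x ≤
      2 * ∑ i, ∑ j, ev (MvPolynomial.pderiv j (p i).1) x ^ 2 := by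
  simp only [curlAt, dotProduct, gradAt, Fin.sum_univ_three, Matrix.cons_val]
  nlinarith [sq_nonneg (ev (MvPolynomial.pderiv 1 (p 2).1) x + ev (MvPolynomial.pderiv 2 (p 1).1) x),
    sq_nonneg (ev (MvPolynomial.pderiv 2 (p 0).1) x + ev (MvPolynomial.pderiv 0 (p 2).1) x),
    sq_nonneg (ev (MvPolynomial.pderiv 0 (p 1).1) x + ev (MvPolynomial.pderiv 1 (p 0).1) x),
    sq_nonneg (ev (MvPolynomial.pderiv 0 (p 0).1) x),
    sq_nonneg (ev (MvPolynomial.pderiv 1 (p 1).1) x),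
    sq_nonneg (ev (MvPolynomial.pderiv 2 (p 2).1) x)]

namespace PolyMesh

variable {Ω : Set E3} {N M : ℕ} (𝒯 : PolyMesh Ω N M) {k : ℕ}

/-- The boundary term of the weak curl vanishes for the test function, so the weak curl is
controlled by the inverse inequality alone. -/
theorem cellInt_weakCurl_testFun_le {K : ℝ} (hK : 0 < K) (T : Fin N)
    (hinv : ∀ p : Poly (k - 1), ∀ i, 𝒯.cellInt T (fun x => ev (MvPolynomial.pderiv i p) x ^ 2)
        ≤ K / 𝒯.hT T ^ 2 * 𝒯.cellInt T (fun x => ev p x ^ 2))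
    (q : WSpace k N) (g : Fin M → Poly k) :
    𝒯.cellInt T (fun x => evVec (𝒯.weakCurl (𝒯.testFun q g) T) x ⬝ᵥ
        evVec (𝒯.weakCurl (𝒯.testFun q g) T) x)
      ≤ 6 * K / 𝒯.hT T ^ 2 * (𝒯.h ^ 4 *
        𝒯.cellInt T (fun x => gradAt (q T) x ⬝ᵥ gradAt (q T) x)) := by
  set v := 𝒯.testFun q g with hv
  set c := 𝒯.weakCurl v T with hc
  set X := 𝒯.cellInt T (fun x => evVec c x ⬝ᵥ evVec c x) with hX
  set G := 𝒯.cellInt T (fun x => gradAt (q T) x ⬝ᵥ gradAt (q T) x) with hG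
  have hT := 𝒯.hT_pos T
  have hcc := continuous_curlAt c
  have hgc := continuous_gradAt (q T).1
  have hcc' (a : ℝ) : Continuous fun x => a * (curlAt c x ⬝ᵥ curlAt c x) :=
    continuous_const.mul (hcc.dotProduct hcc)
  have hgc' (a b : ℝ) : Continuous fun x => a * (b * (gradAt (q T) x ⬝ᵥ gradAt (q T) x)) :=
    continuous_const.mul (continuous_const.mul (hgc.dotProduct hgc))
  have hweak : X = 𝒯.cellInt T (fun x => evVec (v.inner T) x ⬝ᵥ curlAt c x) := by
    rw [hX, 𝒯.isWeakCurl_weakCurl v T c]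
    have : 𝒯.bdryInt T (fun e n x => (evVec (v.bdry e) x ⨯₃ n) ⬝ᵥ evVec c x) = 0 := by
      simp [bdryInt, hv, bdry_testFun_cross, faceInt]
    rw [this, sub_zero]
  have hcurl : 𝒯.cellInt T (fun x => curlAt c x ⬝ᵥ curlAt c x) ≤ 6 * K / 𝒯.hT T ^ 2 * X := by
    have hp : ∀ i j, Continuous fun x => ev (MvPolynomial.pderiv j (c i).1) x ^ 2 :=
      fun i j => (continuous_ev _).pow 2
    calc 𝒯.cellInt T (fun x => curlAt c x ⬝ᵥ curlAt c x)
        ≤ 𝒯.cellInt T (fun x => 2 * ∑ i, ∑ j, ev (MvPolynomial.pderiv j (c i).1) x ^ 2) :=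
          𝒯.cellInt_mono T (hcc.dotProduct hcc)
            (continuous_const.mul (continuous_finsetSum _ fun i _ =>
              continuous_finsetSum _ fun j _ => hp i j)) fun x _ => curlAt_sq_le c x
      _ = 2 * ∑ i, ∑ j, 𝒯.cellInt T (fun x => ev (MvPolynomial.pderiv j (c i).1) x ^ 2) := by
          rw [𝒯.cellInt_const_mul, 𝒯.cellInt_sum _ T
            (f := fun i x => ∑ j, ev (MvPolynomial.pderiv j (c i).1) x ^ 2)
            fun i => continuous_finsetSum _ fun j _ => hp i j]
          congr 1
          exact Finset.sum_congr rfl fun i _ => 𝒯.cellInt_sum _ T (hp i)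
      _ ≤ 2 * ∑ i, ∑ _j : Fin 3, K / 𝒯.hT T ^ 2 * 𝒯.cellInt T (fun x => ev (c i) x ^ 2) := by
          gcongr with i _ j _
          exact hinv (c i) j
      _ = 6 * K / 𝒯.hT T ^ 2 * X := by
          have : X = ∑ i, 𝒯.cellInt T (fun x => ev (c i) x ^ 2) := by
            rw [hX, ← 𝒯.cellInt_sum _ T (f := fun i x => ev (c i) x ^ 2)
              fun i => (continuous_ev (c i).1).pow 2]
            simp only [dotProduct, evVec, sq]
          rw [this, Finset.mul_sum, Finset.mul_sum]
          refine Finset.sum_congr rfl fun i _ => ?_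
          simp only [Finset.sum_const, Finset.card_univ, Fintype.card_fin, nsmul_eq_mul]
          push_cast
          ring
  set t : ℝ := 𝒯.hT T ^ 2 / (6 * K) with ht
  have ht0 : 0 < t := by positivity
  -- Young's inequality, with the parameter that makes the curl term absorbable
  have hyoung : X ≤ (2 * t)⁻¹ * (𝒯.h ^ 4 * G) +
      t / 2 * 𝒯.cellInt T (fun x => curlAt c x ⬝ᵥ curlAt c x) := by
    rw [hweak, hG, ← 𝒯.cellInt_const_mul, ← 𝒯.cellInt_const_mul, ← 𝒯.cellInt_const_mul,
      ← 𝒯.cellInt_add T (hgc' _ _) (hcc' _)]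
    refine 𝒯.cellInt_mono T ((continuous_evVec _).dotProduct hcc)
      ((hgc' _ _).add (hcc' _)) fun x _ => ?_
    rw [hv, evVec_inner_testFun, smul_dotProduct, smul_eq_mul]
    set u := gradAt (q T).1 x
    set w := curlAt c x
    have h1 : 0 ≤ (𝒯.h ^ 2 • u + t • w) ⬝ᵥ (𝒯.h ^ 2 • u + t • w) := by
      simpa using dotProduct_star_self_nonneg (𝒯.h ^ 2 • u + t • w)
    have h2 : (𝒯.h ^ 2 • u + t • w) ⬝ᵥ (𝒯.h ^ 2 • u + t • w)
        = 𝒯.h ^ 4 * (u ⬝ᵥ u) + 2 * t * (𝒯.h ^ 2 * (u ⬝ᵥ w)) + t ^ 2 * (w ⬝ᵥ w) := by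
      simp only [add_dotProduct, dotProduct_add, smul_dotProduct, dotProduct_smul, smul_eq_mul,
        dotProduct_comm w u]
      ring
    rw [h2] at h1
    have h3 : (2 * t)⁻¹ * (𝒯.h ^ 4 * (u ⬝ᵥ u)) + t / 2 * (w ⬝ᵥ w) - -𝒯.h ^ 2 * (u ⬝ᵥ w)
        = (2 * t)⁻¹ * (𝒯.h ^ 4 * (u ⬝ᵥ u) + 2 * t * (𝒯.h ^ 2 * (u ⬝ᵥ w)) + t ^ 2 * (w ⬝ᵥ w)) := by
      field_simp
      ring
    have h4 : 0 ≤ (2 * t)⁻¹ := by positivity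
    linarith [mul_nonneg h4 h1]
  have h5 : t / 2 * (6 * K / 𝒯.hT T ^ 2 * X) = X / 2 := by rw [ht]; field_simp
  have h6 := mul_le_mul_of_nonneg_left hcurl (by positivity : 0 ≤ t / 2)
  rw [h5] at h6
  have h7 : 6 * K / 𝒯.hT T ^ 2 * (𝒯.h ^ 4 * G) = 2 * ((2 * t)⁻¹ * (𝒯.h ^ 4 * G)) := by
    rw [ht]; field_simp
  rw [h7]
  linarith

/-- The energy seminorm of the test function, in terms of `∇q` and of the normal component. -/
theorem exists_a_testFun_le (k : ℕ) {ρ : ℝ} (hρ : 0 < ρ) (n : ℕ) {α : ℝ} (Λ : ℝ) (hα : 0 < α) :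
    ∃ C > 0, ∀ (Ω : Set E3) (N M : ℕ) (𝒯 : PolyMesh Ω N M), 𝒯.ShapeRegular ρ n →
      𝒯.QuasiUniform ρ → ∀ μ κ : Fin N → Matrix (Fin 3) (Fin 3) ℝ,
      (∀ T, IsSymmBetween α Λ (μ T)) → (∀ T, IsSymmBetween α Λ (κ T)) →
      ∀ (q : WSpace k N) (g : Fin M → Poly k),
      𝒯.a μ κ (𝒯.testFun q g) (𝒯.testFun q g) ≤
        C * (𝒯.h ^ 2 * ∑ T, 𝒯.cellInt T (fun x => gradAt (q T) x ⬝ᵥ gradAt (q T) x) +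
          𝒯.h⁻¹ * ∑ e, 𝒯.faceInt e (fun x => ev (g e) x ^ 2)) := by
  obtain ⟨K, hK, H⟩ := exists_trace_inverse_le (k - 1) hρ
  set A : ℝ := |Λ| * (6 * K) / ρ ^ 2 + (2 * Λ ^ 2 + 1) * n * K / ρ ^ 2 with hA
  refine ⟨A + 4 / ρ, by positivity, fun Ω N M 𝒯 hreg hqu μ κ hμ hκ q g => ?_⟩
  set v := 𝒯.testFun q g with hv
  set G : Fin N → ℝ := fun T => 𝒯.cellInt T (fun x => gradAt (q T) x ⬝ᵥ gradAt (q T) x) with hG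
  set D : Fin M → ℝ := fun e => 𝒯.faceInt e (fun x => ev (g e) x ^ 2) with hD
  have hsq : ∀ u : Fin 3 → ℝ, 0 ≤ u ⬝ᵥ u := fun u => by
    simpa using dotProduct_star_self_nonneg u
  have hG0 : ∀ T, 0 ≤ G T := fun T => 𝒯.cellInt_nonneg T fun x => hsq _
  have hD0 : ∀ e, 0 ≤ D e := fun e => 𝒯.faceInt_nonneg e fun x => sq_nonneg _
  have hgc := fun T => continuous_gradAt (q T).1
  have hgg := fun T => (hgc T).dotProduct (hgc T)
  -- the weak curl
  have hcurl : ∀ T, 𝒯.cellInt T (fun x => (κ T *ᵥ evVec (𝒯.weakCurl v T) x) ⬝ᵥ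
      evVec (𝒯.weakCurl v T) x) ≤ |Λ| * (6 * K) / ρ ^ 2 * (𝒯.h ^ 2 * G T) := by
    intro T
    have hT := 𝒯.hT_pos T
    have hcv := continuous_evVec (𝒯.weakCurl v T)
    calc 𝒯.cellInt T (fun x => (κ T *ᵥ evVec (𝒯.weakCurl v T) x) ⬝ᵥ evVec (𝒯.weakCurl v T) x)
        ≤ 𝒯.cellInt T (fun x => |Λ| * (evVec (𝒯.weakCurl v T) x ⬝ᵥ evVec (𝒯.weakCurl v T) x)) := by
          refine 𝒯.cellInt_mono T ((continuous_const.matrix_mulVec hcv).dotProduct hcv)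
            (continuous_const.mul (hcv.dotProduct hcv)) fun x _ => ?_
          rw [dotProduct_comm]
          refine ((hκ T).2 _).2.trans ?_
          exact mul_le_mul_of_nonneg_right (le_abs_self Λ) (hsq _)
      _ = |Λ| * 𝒯.cellInt T (fun x => evVec (𝒯.weakCurl v T) x ⬝ᵥ evVec (𝒯.weakCurl v T) x) :=
          𝒯.cellInt_const_mul T _ _
      _ ≤ |Λ| * (6 * K / 𝒯.hT T ^ 2 * (𝒯.h ^ 4 * G T)) := by
          refine mul_le_mul_of_nonneg_left ?_ (abs_nonneg Λ)
          exact 𝒯.cellInt_weakCurl_testFun_le hK T (fun p => (H Ω N M n 𝒯 hreg T p).2) q g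
      _ ≤ |Λ| * (6 * K / (ρ * 𝒯.h) ^ 2 * (𝒯.h ^ 4 * G T)) := by
          have hh : 0 < 𝒯.h := hT.trans_le (𝒯.hT_le_h T)
          have := hqu T
          have := hG0 T
          gcongr
      _ = |Λ| * (6 * K) / ρ ^ 2 * (𝒯.h ^ 2 * G T) := by
          have hh : 0 < 𝒯.h := hT.trans_le (𝒯.hT_le_h T)
          field_simp
  -- the trace of the gradient
  have htrace : ∀ T, ∀ e ∈ 𝒯.facesOf T,
      𝒯.faceInt e (fun x => gradAt (q T) x ⬝ᵥ gradAt (q T) x) ≤ K / 𝒯.hT T * G T := by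
    intro T e he
    have hp : ∀ i, Continuous fun x => ev (MvPolynomial.pderiv i (q T).1) x ^ 2 :=
      fun i => (continuous_ev _).pow 2
    simp only [hG, dotProduct, gradAt, ← sq]
    rw [𝒯.faceInt_sum _ e hp, 𝒯.cellInt_sum _ T hp, Finset.mul_sum]
    refine Finset.sum_le_sum fun i _ => ?_
    exact (H Ω N M n 𝒯 hreg T ⟨_, pderiv_mem_restrictTotalDegree (q T).2 i⟩).1 e he
  -- the stabilizer, face by face
  have hn1 := fun T e => 𝒯.outNormal_dotProduct_self T e
  have hstab : ∀ T, ∀ e ∈ 𝒯.facesOf T,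
      𝒯.faceInt e (fun x =>
        ((μ T *ᵥ evVec (v.inner T) x - evVec (v.bdry e) x) ⬝ᵥ (𝒯.outNormal T e).ofLp) *
        ((μ T *ᵥ evVec (v.inner T) x - evVec (v.bdry e) x) ⬝ᵥ (𝒯.outNormal T e).ofLp)) +
      𝒯.faceInt e (fun x =>
        ((evVec (v.inner T) x - evVec (v.bdry e) x) ⨯₃ (𝒯.outNormal T e).ofLp) ⬝ᵥ
        ((evVec (v.inner T) x - evVec (v.bdry e) x) ⨯₃ (𝒯.outNormal T e).ofLp)) ≤
      (2 * Λ ^ 2 + 1) * 𝒯.h ^ 4 * (K / 𝒯.hT T * G T) + 2 * D e := by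
    intro T e he
    have hvi := continuous_evVec (v.inner T)
    have hvb := continuous_evVec (v.bdry e)
    have hc1 : Continuous fun x =>
        (μ T *ᵥ evVec (v.inner T) x - evVec (v.bdry e) x) ⬝ᵥ (𝒯.outNormal T e).ofLp :=
      ((continuous_const.matrix_mulVec hvi).sub hvb).dotProduct continuous_const
    have hc1' : Continuous fun x =>
        ((μ T *ᵥ evVec (v.inner T) x - evVec (v.bdry e) x) ⬝ᵥ (𝒯.outNormal T e).ofLp) *
        ((μ T *ᵥ evVec (v.inner T) x - evVec (v.bdry e) x) ⬝ᵥ (𝒯.outNormal T e).ofLp) :=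
      hc1.mul hc1
    have hc2 : Continuous fun x =>
        (evVec (v.inner T) x - evVec (v.bdry e) x) ⨯₃ (𝒯.outNormal T e).ofLp :=
      continuous_crossProduct (hvi.sub hvb) continuous_const
    have hc3 : Continuous fun x =>
        (2 * Λ ^ 2 + 1) * 𝒯.h ^ 4 * (gradAt (q T) x ⬝ᵥ gradAt (q T) x) :=
      continuous_const.mul (hgg T)
    have hc4 : Continuous fun x => 2 * ev (g e) x ^ 2 :=
      continuous_const.mul ((continuous_ev _).pow 2)
    rw [← 𝒯.faceInt_add e hc1' (hc2.dotProduct hc2)]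
    have hpt : ∀ x, ((μ T *ᵥ evVec (v.inner T) x - evVec (v.bdry e) x) ⬝ᵥ
          (𝒯.outNormal T e).ofLp) *
        ((μ T *ᵥ evVec (v.inner T) x - evVec (v.bdry e) x) ⬝ᵥ (𝒯.outNormal T e).ofLp) +
        ((evVec (v.inner T) x - evVec (v.bdry e) x) ⨯₃ (𝒯.outNormal T e).ofLp) ⬝ᵥ
        ((evVec (v.inner T) x - evVec (v.bdry e) x) ⨯₃ (𝒯.outNormal T e).ofLp) ≤
        (2 * Λ ^ 2 + 1) * 𝒯.h ^ 4 * (gradAt (q T) x ⬝ᵥ gradAt (q T) x) +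
          2 * ev (g e) x ^ 2 := by
      intro x
      set ν := (𝒯.outNormal T e).ofLp with hν
      set u := gradAt (q T).1 x with hu
      have e1 : evVec (v.inner T) x = (-𝒯.h ^ 2) • u := 𝒯.evVec_inner_testFun q g T x
      have e2 : (evVec (v.bdry e) x ⬝ᵥ ν) ^ 2 = ev (g e) x ^ 2 := by
        rw [hv, evVec_bdry_testFun, smul_dotProduct, smul_eq_mul, mul_pow, hν]
        rcases 𝒯.outNormal_eq_or T e with h | h <;> simp [h, normal_dotProduct_self]
      have e3 : evVec (v.bdry e) x ⨯₃ ν = 0 := 𝒯.bdry_testFun_cross q g T e x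
      have e4 : evVec (v.inner T) x ⬝ᵥ evVec (v.inner T) x = 𝒯.h ^ 4 * (u ⬝ᵥ u) := by
        rw [e1, smul_dotProduct, dotProduct_smul, smul_eq_mul, smul_eq_mul]
        ring
      have b1 : (evVec (v.inner T) x ⨯₃ ν) ⬝ᵥ (evVec (v.inner T) x ⨯₃ ν)
          ≤ 𝒯.h ^ 4 * (u ⬝ᵥ u) := by
        have := cross_dotProduct_cross_le (evVec (v.inner T) x) ν
        rwa [e4, hn1 T e, mul_one] at this
      have b2 : ((μ T *ᵥ evVec (v.inner T) x) ⬝ᵥ ν) ^ 2 ≤ Λ ^ 2 * (𝒯.h ^ 4 * (u ⬝ᵥ u)) := by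
        have h1 := sq_dotProduct_le (μ T *ᵥ evVec (v.inner T) x) ν
        rw [hn1 T e, mul_one] at h1
        have h2 := (hμ T).mulVec_sq_le hα (evVec (v.inner T) x)
        rw [e4] at h2
        exact h1.trans h2
      rw [sub_dotProduct, map_sub, LinearMap.sub_apply, e3, sub_zero]
      set s := (μ T *ᵥ evVec (v.inner T) x) ⬝ᵥ ν
      set w := evVec (v.bdry e) x ⬝ᵥ ν
      nlinarith [sq_nonneg (s + w)]
    refine (𝒯.faceInt_mono e (hc1'.add (hc2.dotProduct hc2)) (hc3.add hc4) fun x _ => hpt x).trans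
      ((𝒯.faceInt_add e hc3 hc4).trans_le ?_)
    rw [𝒯.faceInt_const_mul, 𝒯.faceInt_const_mul]
    have := htrace T e he
    gcongr
  have hs : 𝒯.s μ v v ≤ ∑ T, (2 * Λ ^ 2 + 1) * n * K / ρ ^ 2 * (𝒯.h ^ 2 * G T) +
      4 / ρ * (𝒯.h⁻¹ * ∑ e, D e) := by
    have h1 : 𝒯.s μ v v ≤ ∑ T, ((2 * Λ ^ 2 + 1) * n * K / ρ ^ 2 * (𝒯.h ^ 2 * G T) +
        ∑ e ∈ 𝒯.facesOf T, 2 / (ρ * 𝒯.h) * D e) := by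
      rw [s, ← Finset.sum_add_distrib]
      refine Finset.sum_le_sum fun T _ => ?_
      have hT := 𝒯.hT_pos T
      have hh : 0 < 𝒯.h := hT.trans_le (𝒯.hT_le_h T)
      have hqT := hqu T
      have hGT := hG0 T
      simp only [bdryInt]
      rw [← mul_add, ← Finset.sum_add_distrib]
      calc (𝒯.hT T)⁻¹ * _
          ≤ (𝒯.hT T)⁻¹ * ∑ e ∈ 𝒯.facesOf T,
            ((2 * Λ ^ 2 + 1) * 𝒯.h ^ 4 * (K / 𝒯.hT T * G T) + 2 * D e) := by
            refine mul_le_mul_of_nonneg_left ?_ (by positivity)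
            exact Finset.sum_le_sum fun e he => hstab T e he
        _ ≤ (ρ * 𝒯.h)⁻¹ * ∑ e ∈ 𝒯.facesOf T,
            ((2 * Λ ^ 2 + 1) * 𝒯.h ^ 4 * (K / (ρ * 𝒯.h) * G T) + 2 * D e) := by
            have := fun e => hD0 e
            gcongr
            exact Finset.sum_nonneg fun e _ => by have := hD0 e; positivity
        _ = (2 * Λ ^ 2 + 1) * (𝒯.facesOf T).card * K / ρ ^ 2 * (𝒯.h ^ 2 * G T) +
            ∑ e ∈ 𝒯.facesOf T, 2 / (ρ * 𝒯.h) * D e := by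
            rw [Finset.sum_add_distrib, Finset.sum_const, nsmul_eq_mul, mul_add]
            congr 1
            · field_simp
            · rw [Finset.mul_sum]
              refine Finset.sum_congr rfl fun e _ => ?_
              field_simp
        _ ≤ _ := by
            have : ((𝒯.facesOf T).card : ℝ) ≤ n := by exact_mod_cast hreg.card_le T
            gcongr
    refine h1.trans ?_
    rw [Finset.sum_add_distrib, 𝒯.sum_facesOf fun _ e => 2 / (ρ * 𝒯.h) * D e, Finset.mul_sum,
      Finset.mul_sum]
    gcongr with e _
    have hh : 0 < 𝒯.h := (𝒯.hT_pos (𝒯.left e)).trans_le (𝒯.hT_le_h _)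
    have hDe := hD0 e
    have h4 : 4 / ρ * (𝒯.h⁻¹ * D e) = 2 / (ρ * 𝒯.h) * D e + 2 / (ρ * 𝒯.h) * D e := by
      field_simp
      ring
    rw [h4]
    gcongr
    rcases 𝒯.right e with _ | T
    · simp only [Option.elim]; positivity
    · simp
  have hsumG : 0 ≤ ∑ T, G T := Finset.sum_nonneg fun T _ => hG0 T
  have hh0 : 0 ≤ 𝒯.h := Real.iSup_nonneg fun T => (𝒯.hT_pos T).le
  have hsumD : 0 ≤ 𝒯.h⁻¹ * ∑ e, D e :=
    mul_nonneg (inv_nonneg.2 hh0) (Finset.sum_nonneg fun e _ => hD0 e)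
  calc 𝒯.a μ κ v v
      ≤ ∑ T, |Λ| * (6 * K) / ρ ^ 2 * (𝒯.h ^ 2 * G T) +
        (∑ T, (2 * Λ ^ 2 + 1) * n * K / ρ ^ 2 * (𝒯.h ^ 2 * G T) +
          4 / ρ * (𝒯.h⁻¹ * ∑ e, D e)) := by
        rw [a]
        exact add_le_add (Finset.sum_le_sum fun T _ => hcurl T) hs
    _ = A * (𝒯.h ^ 2 * ∑ T, G T) + 4 / ρ * (𝒯.h⁻¹ * ∑ e, D e) := by
        simp only [← Finset.mul_sum]
        rw [hA]
        ring
    _ ≤ (A + 4 / ρ) * (𝒯.h ^ 2 * ∑ T, G T + 𝒯.h⁻¹ * ∑ e, D e) := by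
        have hA0 : 0 ≤ A := by positivity
        have hρ' : 0 ≤ 4 / ρ := by positivity
        have := mul_nonneg hA0 hsumD
        have := mul_nonneg hρ' (mul_nonneg (sq_nonneg 𝒯.h) hsumG)
        linarith

end PolyMesh

/-! ### Boundary faces and the components of the boundary -/

/-- A connected nonempty part of the boundary lies in exactly one boundary component. -/
theorem IsBoundaryComponents.existsUnique_subset {Ω : Set E3} {m : ℕ} {Γ : Fin (m + 1) → Set E3}
    (hΓ : IsBoundaryComponents Ω Γ) {e : Set E3} (he : IsConnected e) (hsub : e ⊆ frontier Ω) :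
    ∃ i, ∀ j, e ⊆ Γ j ↔ j = i := by
  obtain ⟨x, hx⟩ := he.nonempty
  have hcomp : ∀ i, x ∈ Γ i → Γ i = connectedComponentIn (frontier Ω) x := by
    intro i hi
    obtain ⟨y, -, hy⟩ := hΓ.component i
    rw [hy] at hi ⊢
    exact connectedComponentIn_eq hi
  have hxΓ : x ∈ ⋃ i, Γ i := by rw [hΓ.iUnion_eq]; exact hsub hx
  obtain ⟨i, hi⟩ := mem_iUnion.1 hxΓ
  refine ⟨i, fun j => ⟨fun hj => hΓ.injective ?_, ?_⟩⟩
  · rw [hcomp i hi, hcomp j (hj hx)]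
  · rintro rfl
    rw [hcomp j hi]
    exact he.isPreconnected.subset_connectedComponentIn hx hsub

namespace PolyMesh

variable {Ω : Set E3} {N M : ℕ} (𝒯 : PolyMesh Ω N M) {k m : ℕ}

theorem exists_componentIndex {Γ : Fin (m + 1) → Set E3} (hΓ : IsBoundaryComponents Ω Γ) :
    ∃ ι : Fin M → Fin (m + 1), ∀ e, 𝒯.right e = none → ∀ j, 𝒯.face e ⊆ Γ j ↔ j = ι e := by
  have h : ∀ e, ∃ i, 𝒯.right e = none → ∀ j, 𝒯.face e ⊆ Γ j ↔ j = i := by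
    intro e
    by_cases he : 𝒯.right e = none
    · have hsub : 𝒯.face e ⊆ frontier Ω := by
        rw [𝒯.frontier_domain]
        exact subset_biUnion_of_mem (u := 𝒯.face) he
      obtain ⟨i, hi⟩ := hΓ.existsUnique_subset (𝒯.polygon e).1 hsub
      exact ⟨i, fun _ => hi⟩
    · exact ⟨0, fun h => absurd h he⟩
  choose ι hι using h
  exact ⟨ι, hι⟩

theorem sum_facesIn {Γ : Fin (m + 1) → Set E3} {ι : Fin M → Fin (m + 1)}
    (hι : ∀ e, 𝒯.right e = none → ∀ j, 𝒯.face e ⊆ Γ j ↔ j = ι e) (F : Fin (m + 1) → Fin M → ℝ) :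
    ∑ i, ∑ e ∈ 𝒯.facesIn (Γ i), F i e
      = ∑ e ∈ Finset.univ.filter (fun e => 𝒯.right e = none), F (ι e) e := by
  have h : ∀ i, 𝒯.facesIn (Γ i)
      = (Finset.univ.filter fun e => 𝒯.right e = none).filter fun e => ι e = i := by
    intro i
    ext e
    simp only [facesIn, Finset.mem_filter, Finset.mem_univ, true_and]
    refine and_congr_right fun he => ?_
    rw [hι e he, eq_comm]
  rw [← Finset.sum_fiberwise _ ι fun e => F (ι e) e]
  refine Finset.sum_congr rfl fun i _ => ?_
  rw [h i]
  refine Finset.sum_congr rfl fun e he => ?_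
  rw [(Finset.mem_filter.1 he).2]

/-- Subtracting the average gives mean zero; if the total area vanishes, so do all integrals. -/
theorem sum_faceInt_sub_average (s : Finset (Fin M)) {f : Fin M → E3 → ℝ}
    (hf : ∀ e, Continuous (f e)) :
    ∑ e ∈ s, 𝒯.faceInt e (fun x => f e x -
      (∑ e ∈ s, 𝒯.faceInt e (f e)) / ∑ e ∈ s, 𝒯.faceInt e (fun _ => 1)) = 0 := by
  set J := ∑ e ∈ s, 𝒯.faceInt e (f e) with hJ
  set A := ∑ e ∈ s, 𝒯.faceInt e (fun _ => 1) with hA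
  have h1 : ∀ e, 𝒯.faceInt e (fun x => f e x - J / A)
      = 𝒯.faceInt e (f e) - J / A * 𝒯.faceInt e (fun _ => 1) := by
    intro e
    rw [← 𝒯.faceInt_const_mul]
    simp only [mul_one]
    exact integral_sub (𝒯.integrableOn_face e (hf e)) (𝒯.integrableOn_face e continuous_const)
  simp_rw [h1]
  rw [Finset.sum_sub_distrib, ← Finset.mul_sum, ← hJ, ← hA]
  rcases eq_or_ne A 0 with h0 | h0
  · have h2 : ∀ e ∈ s, 𝒯.faceInt e (fun _ => 1) = 0 :=
      (Finset.sum_eq_zero_iff_of_nonneg fun e _ => 𝒯.faceInt_nonneg e fun _ => zero_le_one).1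
        (hA ▸ h0)
    have h3 : J = 0 := by
      refine Finset.sum_eq_zero fun e he => ?_
      have h4 := h2 e he
      simp only [faceInt, integral_const, measureReal_restrict_apply MeasurableSet.univ, univ_inter,
        smul_eq_mul, mul_one] at h4
      rw [measureReal_eq_zero_iff (𝒯.area_face_lt_top e).ne] at h4
      rw [faceInt, Measure.restrict_eq_zero.2 h4, integral_zero_measure]
    rw [h0, h3]
    simp
  · field_simp
    ring

/-! ### The normal component of the test function -/

/-- The value subtracted from the left trace of `q` on a face: the right trace on an interior face,
the constant `q̄ᵢ` on a boundary face contained in the component with index `ι e = i`. -/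
noncomputable def outerValue (Γ : Fin (m + 1) → Set E3) (ι : Fin M → Fin (m + 1))
    (q : WSpace k N) (e : Fin M) : Poly (k - 1) :=
  (𝒯.right e).elim ⟨MvPolynomial.C (𝒯.qbar Γ q (ι e)), by
    rw [MvPolynomial.mem_restrictTotalDegree, MvPolynomial.totalDegree_C]; exact Nat.zero_le _⟩ q

/-- The normal component of the test function: `h [[q]]` on interior faces and `h (q - q̄ᵢ)` on the
boundary component with index `i`. -/
noncomputable def normalPart (Γ : Fin (m + 1) → Set E3) (ι : Fin M → Fin (m + 1))
    (q : WSpace k N) (e : Fin M) : Poly k :=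
  𝒯.h • ⟨(q (𝒯.left e) - 𝒯.outerValue Γ ι q e : Poly (k - 1)).1,
    Poly.mono (Nat.sub_le k 1) (q (𝒯.left e) - 𝒯.outerValue Γ ι q e).2⟩

theorem ev_normalPart_interior (Γ : Fin (m + 1) → Set E3) (ι : Fin M → Fin (m + 1))
    (q : WSpace k N) {e : Fin M} (he : 𝒯.right e ≠ none) (x : E3) :
    ev (𝒯.normalPart Γ ι q e) x = 𝒯.h * 𝒯.jump q e x := by
  obtain ⟨T, hT⟩ := Option.ne_none_iff_exists'.1 he
  simp only [normalPart, outerValue, jump, hT, Option.elim, Submodule.coe_smul, ev_smul,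
    Submodule.coe_sub, ev_sub]

theorem ev_normalPart_boundary (Γ : Fin (m + 1) → Set E3) (ι : Fin M → Fin (m + 1))
    (q : WSpace k N) {e : Fin M} (he : 𝒯.right e = none) (x : E3) :
    ev (𝒯.normalPart Γ ι q e) x = 𝒯.h * (ev (q (𝒯.left e)) x - 𝒯.qbar Γ q (ι e)) := by
  simp only [normalPart, outerValue, he, Option.elim, Submodule.coe_smul, ev_smul,
    Submodule.coe_sub, ev_sub, ev_C]

theorem sum_faceInt_sub_qbar (Γ : Fin (m + 1) → Set E3) (q : WSpace k N) {i : Fin (m + 1)}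
    (hi : i ≠ 0) :
    ∑ e ∈ 𝒯.facesIn (Γ i), 𝒯.faceInt e (fun x => ev (q (𝒯.left e)) x - 𝒯.qbar Γ q i) = 0 := by
  simp only [qbar, hi, if_false]
  exact 𝒯.sum_faceInt_sub_average (𝒯.facesIn (Γ i)) fun e => continuous_ev (q (𝒯.left e)).1

theorem sum_faceInt_normalPart_sq {Γ : Fin (m + 1) → Set E3} {ι : Fin M → Fin (m + 1)}
    (hι : ∀ e, 𝒯.right e = none → ∀ j, 𝒯.face e ⊆ Γ j ↔ j = ι e) (q : WSpace k N) :
    ∑ e, 𝒯.faceInt e (fun x => ev (𝒯.normalPart Γ ι q e) x ^ 2)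
      = 𝒯.h ^ 2 * (𝒯.jumpSq q + 𝒯.bdrySq Γ q) := by
  rw [bdrySq, 𝒯.sum_facesIn hι, jumpSq, interiorFaces, mul_add, Finset.mul_sum, Finset.mul_sum,
    ← Finset.sum_filter_not_add_sum_filter Finset.univ fun e => 𝒯.right e = none]
  congr 1
  · refine Finset.sum_congr rfl fun e he => ?_
    simp_rw [𝒯.ev_normalPart_interior Γ ι q (Finset.mem_filter.1 he).2, mul_pow]
    exact 𝒯.faceInt_const_mul e _ _
  · refine Finset.sum_congr rfl fun e he => ?_
    simp_rw [𝒯.ev_normalPart_boundary Γ ι q (Finset.mem_filter.1 he).2, mul_pow]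
    exact 𝒯.faceInt_const_mul e _ _

theorem sum_faceInt_normalPart_mul_jump {Γ : Fin (m + 1) → Set E3} {ι : Fin M → Fin (m + 1)}
    (hι : ∀ e, 𝒯.right e = none → ∀ j, 𝒯.face e ⊆ Γ j ↔ j = ι e) (q : WSpace k N) :
    ∑ e, 𝒯.faceInt e (fun x => ev (𝒯.normalPart Γ ι q e) x * 𝒯.jump q e x)
      = 𝒯.h * 𝒯.jumpSq q + 𝒯.h * 𝒯.bdrySq Γ q := by
  have hbd : 𝒯.bdrySq Γ q = ∑ i, ∑ e ∈ 𝒯.facesIn (Γ i), 𝒯.faceInt e (fun x =>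
      (ev (q (𝒯.left e)) x - 𝒯.qbar Γ q i) * ev (q (𝒯.left e)) x) := by
    refine Finset.sum_congr rfl fun i _ => ?_
    have h0 : 𝒯.qbar Γ q i * ∑ e ∈ 𝒯.facesIn (Γ i),
        𝒯.faceInt e (fun x => ev (q (𝒯.left e)) x - 𝒯.qbar Γ q i) = 0 := by
      rcases eq_or_ne i 0 with rfl | hi
      · simp [qbar]
      · rw [𝒯.sum_faceInt_sub_qbar Γ q hi, mul_zero]
    rw [← add_zero (∑ e ∈ 𝒯.facesIn (Γ i), _), ← h0, Finset.mul_sum, ← Finset.sum_add_distrib]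
    refine Finset.sum_congr rfl fun e _ => ?_
    have hc : Continuous fun x => ev (q (𝒯.left e)) x - 𝒯.qbar Γ q i :=
      (continuous_ev _).sub continuous_const
    rw [← 𝒯.faceInt_const_mul, ← 𝒯.faceInt_add e
      (f := fun x => (ev (q (𝒯.left e)) x - 𝒯.qbar Γ q i) ^ 2)
      (g := fun x => 𝒯.qbar Γ q i * (ev (q (𝒯.left e)) x - 𝒯.qbar Γ q i))
      (hc.pow 2) (continuous_const.mul hc)]
    congr 1
    ext x
    ring
  rw [hbd, 𝒯.sum_facesIn hι, jumpSq, interiorFaces, Finset.mul_sum, Finset.mul_sum,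
    ← Finset.sum_filter_not_add_sum_filter Finset.univ fun e => 𝒯.right e = none]
  congr 1
  · refine Finset.sum_congr rfl fun e he => ?_
    simp_rw [𝒯.ev_normalPart_interior Γ ι q (Finset.mem_filter.1 he).2, mul_assoc, ← sq]
    exact 𝒯.faceInt_const_mul e _ _
  · refine Finset.sum_congr rfl fun e he => ?_
    have he' := (Finset.mem_filter.1 he).2
    simp_rw [𝒯.ev_normalPart_boundary Γ ι q he', jump, he', Option.elim, sub_zero, mul_assoc]
    exact 𝒯.faceInt_const_mul e _ _

theorem testFun_normalPart_mem_U0 {Γ : Fin (m + 1) → Set E3} {ι : Fin M → Fin (m + 1)}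
    (hι : ∀ e, 𝒯.right e = none → ∀ j, 𝒯.face e ⊆ Γ j ↔ j = ι e) (q : WSpace k N) :
    𝒯.testFun q (𝒯.normalPart Γ ι q) ∈ 𝒯.U0 Γ := by
  refine ⟨fun e _ x _ => ?_, fun i hi => ?_⟩
  · rw [← 𝒯.outNormal_left e]
    exact 𝒯.bdry_testFun_cross q _ (𝒯.left e) e x
  · simp only [evVec_bdry_testFun, smul_dotProduct, normal_dotProduct_self, smul_eq_mul, mul_one]
    rw [← mul_zero 𝒯.h, ← 𝒯.sum_faceInt_sub_qbar Γ q hi, Finset.mul_sum]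
    refine Finset.sum_congr rfl fun e he => ?_
    simp only [facesIn, Finset.mem_filter, Finset.mem_univ, true_and] at he
    have hie := (hι e he.1 i).1 he.2
    simp_rw [𝒯.ev_normalPart_boundary Γ ι q he.1, ← hie]
    exact 𝒯.faceInt_const_mul e _ _

end PolyMesh

end WG

theorem lemma10p1 (k : ℕ) (hk : 1 ≤ k) (ρ : ℝ) (hρ : 0 < ρ) (n : ℕ)
    (α Λ : ℝ) (hα : 0 < α) :
    ∃ C : ℝ, 0 < C ∧ ∃ β : ℝ, 0 < β ∧
      ∀ (Ω : Set WG.E3), IsOpen Ω → Bornology.IsBounded Ω → IsConnected Ω →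
      ∀ (m : ℕ) (Γ : Fin (m + 1) → Set WG.E3), WG.IsBoundaryComponents Ω Γ →
      ∀ (N M : ℕ) (𝒯 : WG.PolyMesh Ω N M), 𝒯.ShapeRegular ρ n → 𝒯.QuasiUniform ρ →
      ∀ (μ κ : Fin N → Matrix (Fin 3) (Fin 3) ℝ),
        (∀ T, WG.IsSymmBetween α Λ (μ T)) → (∀ T, WG.IsSymmBetween α Λ (κ T)) →
      ∀ q : WG.WSpace k N,
        (∃ v : WG.VSpace k N M, v ∈ 𝒯.U0 Γ ∧
          𝒯.b μ v q =
            𝒯.h ^ 2 * ∑ T, 𝒯.cellInt T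
                (fun x => (μ T *ᵥ WG.gradAt (q T) x) ⬝ᵥ WG.gradAt (q T) x) +
              𝒯.h * 𝒯.jumpSq q + 𝒯.h * 𝒯.bdrySq Γ q ∧
          𝒯.tripleNorm μ κ v ≤ C * 𝒯.normW Γ q) ∧
        -- inf-sup condition: `β ‖q‖ ≤ sup_v b(v, q) / |||v|||` (with `0 / 0 = 0`, `c / 0 = ∞`)
        ENNReal.ofReal (β * 𝒯.normW Γ q) ≤
          ⨆ v ∈ (𝒯.U0 Γ : Set (WG.VSpace k N M)),
            ENNReal.ofReal (𝒯.b μ v q) / ENNReal.ofReal (𝒯.tripleNorm μ κ v) := by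
  obtain ⟨C, hC, H⟩ := WG.PolyMesh.exists_a_testFun_le k hρ n Λ hα
  have hsC : 0 < √C := Real.sqrt_pos.2 hC
  have hα1 : 0 < min α 1 := lt_min hα one_pos
  refine ⟨√C, hsC, min α 1 / √C, by positivity, ?_⟩
  intro Ω _ _ _ m Γ hΓ N M 𝒯 hreg hqu μ κ hμ hκ q
  obtain ⟨ι, hι⟩ := 𝒯.exists_componentIndex hΓ
  set v := 𝒯.testFun q (𝒯.normalPart Γ ι q) with hv
  have hvU : v ∈ 𝒯.U0 Γ := 𝒯.testFun_normalPart_mem_U0 hι q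
  have hb : 𝒯.b μ v q = 𝒯.h ^ 2 * ∑ T, 𝒯.cellInt T
      (fun x => (μ T *ᵥ WG.gradAt (q T) x) ⬝ᵥ WG.gradAt (q T) x) +
        𝒯.h * 𝒯.jumpSq q + 𝒯.h * 𝒯.bdrySq Γ q := by
    rw [hv, 𝒯.b_testFun, 𝒯.sum_faceInt_normalPart_mul_jump hι, add_assoc]
  have hh : 0 ≤ 𝒯.h := Real.iSup_nonneg fun T => (𝒯.hT_pos T).le
  set X := 𝒯.h ^ 2 * ∑ T, 𝒯.cellInt T (fun x => WG.gradAt (q T) x ⬝ᵥ WG.gradAt (q T) x) +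
    𝒯.h * 𝒯.jumpSq q + 𝒯.h * 𝒯.bdrySq Γ q with hX
  have hW : 𝒯.normW Γ q = √X := rfl
  have hsq : ∀ u : Fin 3 → ℝ, 0 ≤ u ⬝ᵥ u := fun u => by
    simpa using dotProduct_star_self_nonneg u
  have hG : 0 ≤ 𝒯.h ^ 2 *
      ∑ T, 𝒯.cellInt T (fun x => WG.gradAt (q T) x ⬝ᵥ WG.gradAt (q T) x) :=
    mul_nonneg (sq_nonneg _) (Finset.sum_nonneg fun T _ => 𝒯.cellInt_nonneg T fun x => hsq _)
  have hJ : 0 ≤ 𝒯.h * 𝒯.jumpSq q :=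
    mul_nonneg hh (Finset.sum_nonneg fun e _ => 𝒯.faceInt_nonneg e fun x => sq_nonneg _)
  have hB : 0 ≤ 𝒯.h * 𝒯.bdrySq Γ q :=
    mul_nonneg hh (Finset.sum_nonneg fun i _ => Finset.sum_nonneg fun e _ =>
      𝒯.faceInt_nonneg e fun x => sq_nonneg _)
  have hX0 : 0 ≤ X := by positivity
  have ht : 𝒯.tripleNorm μ κ v ≤ √C * 𝒯.normW Γ q := by
    rw [hW, ← Real.sqrt_mul hC.le]
    refine Real.sqrt_le_sqrt ((H Ω N M 𝒯 hreg hqu μ κ hμ hκ q _).trans (le_of_eq ?_))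
    rw [𝒯.sum_faceInt_normalPart_sq hι, hX]
    have : 𝒯.h⁻¹ * (𝒯.h ^ 2 * (𝒯.jumpSq q + 𝒯.bdrySq Γ q))
        = 𝒯.h * 𝒯.jumpSq q + 𝒯.h * 𝒯.bdrySq Γ q := by
      -- with `0⁻¹ = 0` the identity also holds for `h = 0`, the value of an empty supremum
      rcases eq_or_ne 𝒯.h 0 with h0 | h0
      · simp [h0]
      · field_simp
    rw [this, add_assoc]
  refine ⟨⟨v, hvU, hb, ht⟩, le_iSup₂_of_le v hvU ?_⟩
  -- coercivity of `b(v, q)` with respect to `‖q‖²`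
  have hbX : min α 1 * X ≤ 𝒯.b μ v q := by
    have h1 : α * ∑ T, 𝒯.cellInt T (fun x => WG.gradAt (q T) x ⬝ᵥ WG.gradAt (q T) x)
        ≤ ∑ T, 𝒯.cellInt T (fun x => (μ T *ᵥ WG.gradAt (q T) x) ⬝ᵥ WG.gradAt (q T) x) := by
      rw [Finset.mul_sum]
      refine Finset.sum_le_sum fun T _ => ?_
      have hc := WG.continuous_gradAt (q T).1
      rw [← 𝒯.cellInt_const_mul]
      refine 𝒯.cellInt_mono T (continuous_const.mul (hc.dotProduct hc))
        ((continuous_const.matrix_mulVec hc).dotProduct hc) fun x _ => ?_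
      rw [dotProduct_comm (μ T *ᵥ _)]
      exact ((hμ T).2 _).1
    have h2 := mul_le_mul_of_nonneg_left h1 (sq_nonneg 𝒯.h)
    have h3 := mul_le_mul_of_nonneg_right (min_le_left α 1) hG
    have h4 := mul_le_mul_of_nonneg_right (min_le_right α 1) hJ
    have h5 := mul_le_mul_of_nonneg_right (min_le_right α 1) hB
    rw [hb, hX]
    linarith
  have hW2 : 𝒯.normW Γ q * 𝒯.normW Γ q = X := by rw [hW, Real.mul_self_sqrt hX0]
  rcases (Real.sqrt_nonneg X).eq_or_lt with h0 | hpos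
  · rw [hW, ← h0]
    simp
  rw [← hW] at hpos
  have hXpos : 0 < X := hW2 ▸ mul_pos hpos hpos
  have hbpos : 0 < 𝒯.b μ v q := (mul_pos hα1 hXpos).trans_le hbX
  rcases (Real.sqrt_nonneg (𝒯.a μ κ v v)).eq_or_lt with ht0 | htpos
  · have : 𝒯.tripleNorm μ κ v = 0 := ht0.symm
    rw [this, ENNReal.ofReal_zero, ENNReal.div_zero (ENNReal.ofReal_pos.2 hbpos).ne']
    exact le_top
  · change 0 < 𝒯.tripleNorm μ κ v at htpos
    rw [← ENNReal.ofReal_div_of_pos htpos]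
    refine ENNReal.ofReal_le_ofReal ?_
    rw [le_div_iff₀ htpos]
    calc min α 1 / √C * 𝒯.normW Γ q * 𝒯.tripleNorm μ κ v
        ≤ min α 1 / √C * 𝒯.normW Γ q * (√C * 𝒯.normW Γ q) := by gcongr
      _ = min α 1 * X := by rw [← hW2]; field_simp
      _ ≤ 𝒯.b μ v q := hbX
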